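/- **Setting.** A *kernel* is a function $k:\mathbb Z\to[0,\infty)$, not identically zero, with $k(0)=0$, $k(-j)=k(j)$ and $\sum_{j}k(j)<\infty$. An operator $L$ on the space $\ell^\infty(\mathbb Z)$ of bounded real functions is generated by $k$ if $Lu(x)=\sum_{y\in\mathbb Z}k(x-y)\,(u(y)-u(x))$ for all $u\in\ell^\infty(\mathbb Z)$, $x\in\mathbb Z$; then $k$ is determined by $L$. With $\Upsilon(r)=e^r-1-r$ put $$\Psi_\Upsilon(u)(x)=\sum_{y}k(x-y)\Upsilon(u(y)-u(x)),\qquad B_{\Upsilon'}(u,v)(x)=\sum_y k(x-y)\Upsilon'(u(y)-u(x))(v(y)-v(x)),$$ $$\Psi_{2,\Upsilon}(u)=\tfrac12\big(L\Psi_\Upsilon(u)-B_{\Upsilon'}(u,Lu)\big).$$ A *$CD$-function* is a continuous $F:[0,\infty)\to[0,\infty)$ with $F(0)=0$, $r\mapsto F(r)/r$ strictly increasing on $(0,\infty)$ and $1/F$ integrable at $\infty$. The operator $L$ satisfies $CD_\Upsilon(\kappa,F)$ if it is generated by a kernel and $$\Psi_{2,\Upsilon}(u)(x)\ \ge\ \kappa\,\Psi_\Upsilon(u)(x)+F_0(-Lu(x))\qquad\text{for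 all }u\in\ell^\infty(\mathbb Z),\ x\in\mathbb Z,$$ where $F_0=F$ on $[0,\infty)$ and $F_0=0$ on $(-\infty,0)$. Let $\Delta u(x)=u(x+1)+u(x-1)-2u(x)$ be the discrete Laplacian on $\mathbb Z$, $e^{t\Delta}=\sum_{n\ge0}\frac{t^n}{n!}\Delta^n$ its heat semigroup on $\ell^\infty(\mathbb Z)$ and, for $\beta\in(0,2)$, $$(-\Delta)^{\beta/2}u(x)=\frac1{\Gamma(-\beta/2)}\int_0^\infty\big(e^{t\Delta}u(x)-u(x)\big)\,\frac{dt}{t^{1+\beta/2}},\qquad u\in\ell^\infty(\mathbb Z).$$ Write $f(r)\sim g(r)$ if $f(r)/g(r)\to1$, and let $\beta_*=\frac{1+\sqrt5}2$. **Statement.** Let $\beta\in(0,2)$. There exist constants $c_1,c_2,c_3,c_4,\nu>0$ such that: (i) if $\beta\in(0,\beta_*]$, then $-(-\Delta)^{\beta/2}$ satisfies $CD_\Upsilon(0,F)$ with a $CD$-function $F$ such that $$F(r)\sim c_1\,r^{\frac{1+2\beta}{\beta}}\ \text{ as } r\to0^+,\qquad F(r)\sim c_2\,e^{\nu r}\ \text{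 as } r\to\infty;$$ (ii) if $\beta\in(\beta_*,2)$, then for every $\varepsilon\in(0,\beta-1)$ the operator $-(-\Delta)^{\beta/2}$ satisfies $CD_\Upsilon(0,F)$ with a $CD$-function $F$ (depending on $\varepsilon$) such that $$F(r)\sim c_3\,r^{\frac{\beta-\varepsilon}{\beta-\varepsilon-1}}\ \text{ as } r\to0^+,\qquad F(r)\sim c_4\,e^{\nu r}\ \text{ as } r\to\infty.$$ -/

import Mathlib

open Filter Topology MeasureTheory Asymptotics

noncomputable section

/-- The space `ℓ^∞(ℤ)` of bounded functions. -/
def IsBoundedFun (u : ℤ → ℝ) : Prop := ∃ C : ℝ, ∀ x, |u x| ≤ C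

/-- The kernels `k : ℤ → [0, ∞)` of the theory: non-trivial, symmetric, summable, with the
convention `k 0 = 0`. -/
structure IsKernel (k : ℤ → ℝ) : Prop where
  nonneg : ∀ j, 0 ≤ k j
  zero : k 0 = 0
  symm : ∀ j, k (-j) = k j
  summable : Summable k
  nontrivial : ∃ j, k j ≠ 0

/-- The operator generated by the kernel `k`: `L u (x) = ∑_y k(x - y) (u(y) - u(x))`. -/
def kernelOp (k : ℤ → ℝ) (u : ℤ → ℝ) (x : ℤ) : ℝ :=
  ∑' y : ℤ, k (x - y) * (u y - u x)

/-- `Υ(r) = e^r - 1 - r`. -/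
def Upsilon (r : ℝ) : ℝ := Real.exp r - 1 - r

/-- `Υ'(r) = e^r - 1`. -/
def UpsilonDeriv (r : ℝ) : ℝ := Real.exp r - 1

theorem hasDerivAt_Upsilon (r : ℝ) : HasDerivAt Upsilon (UpsilonDeriv r) r := by
  have h := ((Real.hasDerivAt_exp r).sub_const 1).sub (hasDerivAt_id r)
  exact h

/-- `Ψ_Υ(u)(x) = ∑_y k(x - y) Υ(u(y) - u(x))`. -/
def PsiUpsilon (k : ℤ → ℝ) (u : ℤ → ℝ) (x : ℤ) : ℝ :=
  ∑' y : ℤ, k (x - y) * Upsilon (u y - u x)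

/-- `B_{Υ'}(u, v)(x) = ∑_y k(x - y) Υ'(u(y) - u(x)) (v(y) - v(x))`. -/
def BUpsilonDeriv (k : ℤ → ℝ) (u v : ℤ → ℝ) (x : ℤ) : ℝ :=
  ∑' y : ℤ, k (x - y) * UpsilonDeriv (u y - u x) * (v y - v x)

/-- `Ψ_{2,Υ}(u) = (L Ψ_Υ(u) - B_{Υ'}(u, L u)) / 2`. -/
def Psi2Upsilon (k : ℤ → ℝ) (u : ℤ → ℝ) (x : ℤ) : ℝ :=
  (1 / 2) * (kernelOp k (PsiUpsilon k u) x - BUpsilonDeriv k u (kernelOp k u) x)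

/-- `F : [0, ∞) → [0, ∞)` is a `CD`-function: it is continuous, `F(0) = 0`, `F(r)/r` is strictly
increasing on `(0, ∞)`, and `1/F` is integrable at `∞`. Only the values of `F` on `[0, ∞)`
matter. -/
structure IsCDFunction (F : ℝ → ℝ) : Prop where
  nonneg : ∀ r, 0 ≤ r → 0 ≤ F r
  continuousOn : ContinuousOn F (Set.Ici 0)
  map_zero : F 0 = 0
  strictMonoOn : StrictMonoOn (fun r => F r / r) (Set.Ioi 0)
  integrable_inv : ∃ M : ℝ, 0 < M ∧ IntegrableOn (fun r => 1 / F r) (Set.Ioi M) volume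

/-- The extension `F₀` of `F` by zero: `F₀ = F` on `[0, ∞)` and `F₀(r) = 0` for `r < 0`. -/
def zeroExt (F : ℝ → ℝ) (r : ℝ) : ℝ := if r < 0 then 0 else F r

/-- The operator `T` on bounded functions is generated by the kernel `k`. -/
def IsGeneratedBy (T : (ℤ → ℝ) → ℤ → ℝ) (k : ℤ → ℝ) : Prop :=
  ∀ u : ℤ → ℝ, IsBoundedFun u → ∀ x : ℤ, T u x = kernelOp k u x

/-- There is at most one kernel that generates a given operator. -/
theorem IsGeneratedBy.unique {T : (ℤ → ℝ) → ℤ → ℝ} {k k' : ℤ → ℝ}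
    (hk : IsKernel k) (hk' : IsKernel k') (h : IsGeneratedBy T k) (h' : IsGeneratedBy T k') :
    k = k' := by
  funext j
  by_cases hj : j = 0
  · rw [hj, hk.zero, hk'.zero]
  · have key : ∀ q : ℤ → ℝ, kernelOp q (fun y => if y = 0 then (1 : ℝ) else 0) j = q j := by
      intro q
      unfold kernelOp
      rw [tsum_eq_single 0]
      · simp [hj]
      · intro y hy
        simp [hy, hj]
    have hu : IsBoundedFun (fun y => if y = 0 then (1 : ℝ) else 0) :=
      ⟨1, by intro y; dsimp only; split_ifs <;> simp⟩
    have e := (h _ hu j).symm.trans (h' _ hu j)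
    rwa [key, key] at e

/-- The condition `CD_Υ(κ, F)` for an operator `T` on bounded functions: `T` is generated by a
(necessarily unique) kernel, and for this kernel
`Ψ_{2,Υ}(u)(x) ≥ κ Ψ_Υ(u)(x) + F₀(-T u(x))` for all bounded `u` and all `x`. -/
def SatisfiesCDUpsilon (T : (ℤ → ℝ) → ℤ → ℝ) (κ : ℝ) (F : ℝ → ℝ) : Prop :=
  ∃ k : ℤ → ℝ, IsKernel k ∧ IsGeneratedBy T k ∧
    ∀ u : ℤ → ℝ, IsBoundedFun u → ∀ x : ℤ,
      κ * PsiUpsilon k u x + zeroExt F (-(T u x)) ≤ Psi2Upsilon k u x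

/-- The discrete Laplacian. -/
def discreteLaplacian (u : ℤ → ℝ) (x : ℤ) : ℝ :=
  (u (x + 1) - u x) + (u (x - 1) - u x)

/-- The heat semigroup `e^{tΔ} u = ∑_n (t^n / n!) Δ^n u` of the discrete Laplacian. As `Δ` is a
bounded operator on the bounded functions, of norm at most `4`, the series converges absolutely
for every bounded `u`. -/
def heatSemigroup (t : ℝ) (u : ℤ → ℝ) (x : ℤ) : ℝ :=
  ∑' n : ℕ, t ^ n / (n.factorial : ℝ) * (discreteLaplacian^[n] u) x

/-- The fractional power `(-Δ)^s`, `0 < s < 1`, of the discrete Laplacian, defined by the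
semigroup method:
`(-Δ)^s u(x) = Γ(-s)⁻¹ ∫_0^∞ (e^{tΔ} u(x) - u(x)) t^{-1-s} dt` for bounded `u`. -/
def fracDiscreteLaplacian (s : ℝ) (u : ℤ → ℝ) (x : ℤ) : ℝ :=
  (Real.Gamma (-s))⁻¹ * ∫ t in Set.Ioi (0 : ℝ), (heatSemigroup t u x - u x) * t ^ (-1 - s)

end

/-!
Fix `u` and `x`, and put `v(h) = u(x + h) - u(x)` and `r = -L u(x)`. The theorem rests on the
identity
`2 Ψ_{2,Υ}(u)(x) = ∑_{h,j} k(h) k(j) e^{v(j)} Υ(v(h + j) - v(h) - v(j))`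
(`two_mul_Psi2Upsilon_eq`), a double sum of nonnegative terms, which has to be bounded below in
terms of `r = ∑_{h ≥ 1} k(h) w(h)`, `w(h) = -v(h) - v(-h)`. Write `A` for the double sum.

The diagonal terms `j = -h` give `∑_{h ≥ 1} k(h)² e^{-w(h)/2} Υ(w(h)) ≤ A`
(`diagonalBound_of_kernel`). The function `e^{-w/2} Υ(w)` dominates every power `w^m`, `m ≥ 2`,
for `w ≥ 0`, so that Young's inequality, with a cut-off at `h = N` and `k(h)` of the order of
`h^{-1-β}`, yields `r ≤ C (N^{1+β} A + N^{-β})` for all `N ≥ 1`, hence a lower bound for `A` by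
`r^{(1+2β)/β}` on bounded intervals (`exists_rpow_le_of_diagonal`). Since `e^{-w/2} Υ(w)` also
grows like `e^{w/2}`, the same terms bound `A` below by an exponential of `r` for large `r`
(`exists_exp_le_of_diagonal`).

For `1 < β < 2` the terms with `j = 1` improve the estimate for small `r`. If `A ≤ 1`, then, after
a reflection of `v`, their weight `e^{v(1)}` is bounded below, and they control the second
differences `v(h + 1) - v(h) - v(1)`, of which `w(h)` is a sum. Used for `h ≤ N`, together with
the diagonal terms for `h > N`, they give `r ≤ C (N² A + N^{-β'})` with `β'` arbitrarily close to
`β`. The resulting exponent `1 + 2 / β'` is at most `β / (β - 1)` for a suitable `β'`, and hence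
smaller than the exponent `(β - ε) / (β - ε - 1)` for every `ε` (`exists_rpow_le_of_unitStep`).
This is why all constants can be chosen independently of `ε`.

The `CD`-function is `cdFun`, an explicit sum of a term that fixes the behaviour at `0` and a term
that fixes the behaviour at `∞`.

The kernel of `-(-Δ)^s`, `s = β / 2`, is found by writing `e^{tΔ}` as the semigroup of a random
walk whose displacement is the difference of two independent Poisson variables, and integrating
term by term (`isGeneratedBy_fracKernel`). It satisfies the recursion
`(j + 1 + s) k(j + 1) = (j - s) k(j)` (`fracKernel_recursion`), and Bernoulli's inequality turns
the recursion into two-sided bounds by multiples of `j^{-1-2s}` (`isPowerLike_of_recursion`).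
-/

/-! ### A family of `CD`-functions -/

/-- The function `r ↦ a r (r / (1 + r))^(p - 1) + b (ν r / (1 + ν r))^q e^{ν r}`. The first summand
fixes the behaviour at `0` and grows linearly, the second one fixes the behaviour at `∞` and is of
higher order at `0` if `p < q`. -/
noncomputable def cdFun (a b p q ν r : ℝ) : ℝ :=
  a * (r * (r / (1 + r)) ^ (p - 1)) + b * ((ν * r / (1 + ν * r)) ^ q * Real.exp (ν * r))

theorem div_one_add_strictMonoOn :
    StrictMonoOn (fun r : ℝ => r / (1 + r)) (Set.Ici 0) := by
  intro x hx y hy hxy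
  simp only [Set.mem_Ici] at hx hy
  change x / (1 + x) < y / (1 + y)
  rw [div_lt_div_iff₀ (by linarith) (by linarith)]
  nlinarith

theorem exp_div_one_add_monotoneOn :
    MonotoneOn (fun r : ℝ => Real.exp r / (1 + r)) (Set.Ici 0) := by
  intro x hx y hy hxy
  simp only [Set.mem_Ici] at hx hy
  change Real.exp x / (1 + x) ≤ Real.exp y / (1 + y)
  rw [div_le_div_iff₀ (by linarith) (by linarith)]
  have h : Real.exp y = Real.exp x * Real.exp (y - x) := by rw [← Real.exp_add]; congr 1; ring
  have h2 := Real.add_one_le_exp (y - x)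
  rw [h, mul_assoc]
  refine mul_le_mul_of_nonneg_left ?_ (Real.exp_pos x).le
  nlinarith [mul_nonneg hx (sub_nonneg.2 hxy)]

theorem cdFun_continuousOn {a b p q ν : ℝ} (hp : 1 < p) (hq : 0 < q) (hν : 0 < ν) :
    ContinuousOn (cdFun a b p q ν) (Set.Ici 0) := by
  have h1 : ContinuousOn (fun r : ℝ => r / (1 + r)) (Set.Ici 0) :=
    continuousOn_id.div (by fun_prop) fun x hx => by
      have : (0 : ℝ) ≤ x := hx
      positivity
  have h2 : ContinuousOn (fun r : ℝ => ν * r / (1 + ν * r)) (Set.Ici 0) :=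
    ContinuousOn.div (by fun_prop) (by fun_prop) fun x hx => by
      have : (0 : ℝ) ≤ x := hx
      positivity
  have h3 := h1.rpow_const (p := p - 1) fun x _ => Or.inr (by linarith)
  have h4 := h2.rpow_const (p := q) fun x _ => Or.inr hq.le
  exact (continuousOn_const.mul (continuousOn_id.mul h3)).add
    (continuousOn_const.mul (h4.mul (by fun_prop)))

theorem cdFun_strictMonoOn {a b p q ν : ℝ} (ha : 0 < a) (hb : 0 < b) (hp : 1 < p) (hq : 1 < q)
    (hν : 0 < ν) : StrictMonoOn (fun r => cdFun a b p q ν r / r) (Set.Ioi 0) := by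
  have key : ∀ r : ℝ, 0 < r → cdFun a b p q ν r / r = a * (r / (1 + r)) ^ (p - 1) +
      b * ν * ((ν * r / (1 + ν * r)) ^ (q - 1) * (Real.exp (ν * r) / (1 + ν * r))) := by
    intro r hr
    have h : (ν * r / (1 + ν * r)) ^ q
        = (ν * r / (1 + ν * r)) ^ (q - 1) * (ν * r / (1 + ν * r)) := by
      rw [← Real.rpow_add_one (by positivity)]; congr 1; ring
    unfold cdFun
    rw [h]
    have : (1 + ν * r) ≠ 0 := by positivity
    field_simp
  intro x hx y hy hxy
  simp only [Set.mem_Ioi] at hx hy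
  change cdFun a b p q ν x / x < cdFun a b p q ν y / y
  rw [key x hx, key y hy]
  refine add_lt_add_of_lt_of_le (mul_lt_mul_of_pos_left ?_ ha)
    (mul_le_mul_of_nonneg_left ?_ (by positivity))
  · exact Real.rpow_lt_rpow (by positivity)
      (div_one_add_strictMonoOn hx.le hy.le hxy) (by linarith)
  · have hνx : (0 : ℝ) ≤ ν * x := by positivity
    have hνy : (0 : ℝ) ≤ ν * y := by positivity
    have hlt : ν * x < ν * y := mul_lt_mul_of_pos_left hxy hν
    refine mul_le_mul ?_ (exp_div_one_add_monotoneOn hνx hνy hlt.le) (by positivity)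
      (by positivity)
    exact Real.rpow_le_rpow (by positivity)
      (div_one_add_strictMonoOn hνx hνy hlt).le (by linarith)

theorem isCDFunction_cdFun {a b p q ν : ℝ} (ha : 0 < a) (hb : 0 < b) (hp : 1 < p) (hq : 1 < q)
    (hν : 0 < ν) : IsCDFunction (cdFun a b p q ν) where
  nonneg r hr := by unfold cdFun; positivity
  continuousOn := cdFun_continuousOn hp (by linarith) hν
  map_zero := by
    unfold cdFun
    rw [mul_zero, zero_div, Real.zero_rpow (by linarith : q ≠ 0)]
    simp
  strictMonoOn := cdFun_strictMonoOn ha hb hp hq hν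
  integrable_inv := by
    refine ⟨1 / ν, by positivity, ?_⟩
    have hint : IntegrableOn (fun r => (b * (1 / 2) ^ q)⁻¹ * Real.exp (-ν * r))
        (Set.Ioi (1 / ν)) := (exp_neg_integrableOn_Ioi _ hν).const_mul _
    have hpos : ∀ r ∈ Set.Ioi (1 / ν), b * (1 / 2) ^ q * Real.exp (ν * r) ≤ cdFun a b p q ν r := by
      intro r hr
      have hr1 : 1 < ν * r := by
        have h : 1 / ν < r := hr
        rwa [div_lt_iff₀ hν, mul_comm] at h
      have hr0 : 0 < r := by
        by_contra h
        nlinarith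
      have h1 : (1 / 2 : ℝ) ^ q ≤ (ν * r / (1 + ν * r)) ^ q := by
        refine Real.rpow_le_rpow (by norm_num) ?_ (by linarith)
        rw [div_le_div_iff₀ (by norm_num) (by linarith)]
        linarith
      unfold cdFun
      have h2 : 0 ≤ a * (r * (r / (1 + r)) ^ (p - 1)) := by positivity
      rw [mul_assoc]
      nlinarith [mul_le_mul_of_nonneg_right h1 (Real.exp_pos (ν * r)).le]
    refine Integrable.mono' hint ?_ ?_
    · refine ContinuousOn.aestronglyMeasurable ?_ measurableSet_Ioi
      have hsub : Set.Ioi (1 / ν) ⊆ Set.Ici 0 := fun r hr =>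
        (lt_trans (by positivity : (0 : ℝ) < 1 / ν) hr).le
      refine continuousOn_const.div ((cdFun_continuousOn hp (by linarith) hν).mono hsub) ?_
      intro r hr
      exact (lt_of_lt_of_le (by positivity) (hpos r hr)).ne'
    · refine (ae_restrict_mem measurableSet_Ioi).mono fun r hr => ?_
      have h := hpos r hr
      have h0 : 0 < b * (1 / 2) ^ q * Real.exp (ν * r) := by positivity
      rw [Real.norm_of_nonneg (by positivity [h0.trans_le h]), neg_mul, Real.exp_neg, ← mul_inv,
        one_div]
      exact inv_anti₀ h0 h

theorem cdFun_isEquivalent_zero {a b p q ν : ℝ} (ha : 0 < a) (hpq : p < q)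
    (hν : 0 < ν) : cdFun a b p q ν ~[𝓝[>] 0] (fun r => a * r ^ p) := by
  refine isEquivalent_of_tendsto_one ?_
  have hlim : Tendsto (fun r : ℝ => (1 / (1 + r)) ^ (p - 1) +
      b / a * ((ν / (1 + ν * r)) ^ q * (Real.exp (ν * r) * r ^ (q - p)))) (𝓝[>] 0) (𝓝 1) := by
    have hc : ContinuousAt (fun r : ℝ => (1 / (1 + r)) ^ (p - 1) +
        b / a * ((ν / (1 + ν * r)) ^ q * (Real.exp (ν * r) * r ^ (q - p)))) 0 := by
      have e1 : ContinuousAt (fun r : ℝ => 1 / (1 + r)) 0 :=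
        ContinuousAt.div (by fun_prop) (by fun_prop) (by norm_num)
      have e2 : ContinuousAt (fun r : ℝ => ν / (1 + ν * r)) 0 :=
        ContinuousAt.div (by fun_prop) (by fun_prop) (by norm_num)
      have e3 := e1.rpow_const (p := p - 1) (Or.inl (by norm_num))
      have e4 := e2.rpow_const (p := q) (Or.inl (by simpa using hν.ne'))
      have e5 : ContinuousAt (fun r : ℝ => r ^ (q - p)) 0 :=
        continuousAt_id.rpow_const (Or.inr (by linarith))
      exact e3.add (continuousAt_const.mul (e4.mul ((by fun_prop : ContinuousAt _ _).mul e5)))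
    have h := hc.tendsto.mono_left (nhdsWithin_le_nhds (s := Set.Ioi (0 : ℝ)))
    simpa [Real.zero_rpow (sub_pos.2 hpq).ne'] using h
  refine hlim.congr' ?_
  filter_upwards [self_mem_nhdsWithin] with r hr
  have hr : 0 < r := hr
  simp only [Pi.div_apply]
  unfold cdFun
  rw [Real.div_rpow hr.le (by positivity), Real.div_rpow (by norm_num) (by positivity),
    Real.div_rpow (by positivity) (by positivity), Real.div_rpow (by positivity) (by positivity),
    Real.mul_rpow hν.le hr.le, Real.rpow_sub hr, Real.rpow_sub_one hr.ne', Real.one_rpow]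
  have h1 : (1 + r) ^ (p - 1) ≠ 0 := by positivity
  have h2 : (1 + ν * r) ^ q ≠ 0 := by positivity
  have h3 : r ^ p ≠ 0 := by positivity
  field_simp

theorem cdFun_isEquivalent_atTop {a b p q ν : ℝ} (hb : 0 < b)
    (hν : 0 < ν) : cdFun a b p q ν ~[atTop] (fun r => b * Real.exp (ν * r)) := by
  refine isEquivalent_of_tendsto_one ?_
  have hdiv : Tendsto (fun r : ℝ => r / (1 + r)) atTop (𝓝 1) := by
    have h : Tendsto (fun r : ℝ => 1 - (1 + r)⁻¹) atTop (𝓝 (1 - 0)) :=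
      tendsto_const_nhds.sub
        (tendsto_inv_atTop_zero.comp (tendsto_atTop_add_const_left _ _ tendsto_id))
    rw [sub_zero] at h
    refine h.congr' ?_
    filter_upwards [eventually_gt_atTop 0] with r hr
    have : 1 + r ≠ 0 := by positivity
    field_simp
    ring
  have e1 : Tendsto (fun r : ℝ => (r / (1 + r)) ^ (p - 1)) atTop (𝓝 1) := by
    simpa using hdiv.rpow_const (p := p - 1) (Or.inl one_ne_zero)
  have e2 : Tendsto (fun r : ℝ => (ν * r / (1 + ν * r)) ^ q) atTop (𝓝 1) := by
    simpa using (hdiv.comp (tendsto_id.const_mul_atTop hν)).rpow_const (p := q)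
      (Or.inl one_ne_zero)
  have e3 : Tendsto (fun r : ℝ => r * Real.exp (-(ν * r))) atTop (𝓝 0) := by
    have h := (Real.tendsto_pow_mul_exp_neg_atTop_nhds_zero 1).comp
      (tendsto_id.const_mul_atTop hν)
    have h2 := h.const_mul (1 / ν)
    rw [mul_zero] at h2
    refine h2.congr fun r => ?_
    simp only [Function.comp, id, pow_one]
    field_simp
  have h := ((e3.mul e1).const_mul (a / b)).add e2
  rw [zero_mul, mul_zero, zero_add] at h
  refine h.congr fun r => ?_
  simp only [Pi.div_apply]
  unfold cdFun
  rw [Real.exp_neg]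
  have := Real.exp_pos (ν * r)
  field_simp

/-- A quantity `A` that is bounded below by a power of `r` on bounded intervals and exponentially
for large `r` is bounded below by a multiple of the second summand of `cdFun`. -/
theorem exists_mul_exp_le {S : ℝ → ℝ → Prop} {c ν R q : ℝ} (hc : 0 < c) (hν : 0 < ν)
    (hq : 0 < q) (hE : ∀ r A, S r A → R ≤ r → c * Real.exp (ν * r) ≤ A)
    (hP : ∃ c' : ℝ, 0 < c' ∧ ∀ r A, S r A → 0 < r → r ≤ R → c' * r ^ q ≤ A) :
    ∃ b : ℝ, 0 < b ∧ ∀ r A, S r A → 0 < r →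
      b * ((ν * r / (1 + ν * r)) ^ q * Real.exp (ν * r)) ≤ A := by
  obtain ⟨c', hc', hP⟩ := hP
  refine ⟨min c (c' / (ν ^ q * Real.exp (ν * R))), by positivity, fun r A hS hr => ?_⟩
  rcases le_total r R with h | h
  · refine le_trans ?_ (hP r A hS hr h)
    have h1 : (ν * r / (1 + ν * r)) ^ q * Real.exp (ν * r) ≤ ν ^ q * r ^ q * Real.exp (ν * R) := by
      rw [← Real.mul_rpow hν.le hr.le]
      have : ν * r / (1 + ν * r) ≤ ν * r := div_le_self (by positivity) (by nlinarith)
      gcongr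
    calc _ ≤ c' / (ν ^ q * Real.exp (ν * R)) * (ν ^ q * r ^ q * Real.exp (ν * R)) :=
          mul_le_mul (min_le_right _ _) h1 (by positivity) (by positivity)
      _ = c' * r ^ q := by
          have : ν ^ q ≠ 0 := by positivity
          field_simp
  · refine le_trans ?_ (hE r A hS h)
    refine mul_le_mul (min_le_left _ _) ?_ (by positivity) hc.le
    have : (ν * r / (1 + ν * r)) ^ q ≤ 1 := by
      refine Real.rpow_le_one (by positivity) ?_ hq.le
      rw [div_le_one (by positivity)]
      linarith
    exact mul_le_of_le_one_left (Real.exp_pos _).le this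

/-- Under the assumptions of `exists_mul_exp_le`, the quantity `A` is also bounded below by a
multiple of the first summand of `cdFun`. -/
theorem exists_mul_rpow_le {S : ℝ → ℝ → Prop} {c ν R q : ℝ} (hc : 0 < c) (hν : 0 < ν)
    (hq : 1 < q) (hE : ∀ r A, S r A → R ≤ r → c * Real.exp (ν * r) ≤ A)
    (hP : ∃ c' : ℝ, 0 < c' ∧ ∀ r A, S r A → 0 < r → r ≤ R → c' * r ^ q ≤ A) :
    ∃ a : ℝ, 0 < a ∧ ∀ r A, S r A → 0 < r → a * (r * (r / (1 + r)) ^ (q - 1)) ≤ A := by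
  obtain ⟨c', hc', hP⟩ := hP
  refine ⟨min (c * ν) c', by positivity, fun r A hS hr => ?_⟩
  have hle : r / (1 + r) ≤ r := div_le_self hr.le (by linarith)
  rcases le_total r R with h | h
  · refine le_trans ?_ (hP r A hS hr h)
    refine mul_le_mul (min_le_right _ _) ?_ (by positivity) hc'.le
    calc r * (r / (1 + r)) ^ (q - 1) ≤ r * r ^ (q - 1) := by
          gcongr
      _ = r ^ q := by rw [Real.rpow_sub_one hr.ne']; field_simp
  · refine le_trans ?_ (hE r A hS h)
    have h1 : (r / (1 + r)) ^ (q - 1) ≤ 1 := by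
      refine Real.rpow_le_one (by positivity) ?_ (by linarith)
      rw [div_le_one (by positivity)]
      linarith
    calc _ ≤ c * ν * (r * 1) := mul_le_mul (min_le_left _ _) (by gcongr) (by positivity)
            (by positivity)
      _ ≤ c * Real.exp (ν * r) := by
          have := Real.add_one_le_exp (ν * r)
          nlinarith

/-! ### Elementary inequalities for `Υ` and for power sums -/

theorem Upsilon_nonneg (r : ℝ) : 0 ≤ Upsilon r := by
  unfold Upsilon
  linarith [Real.add_one_le_exp r]

theorem exp_neg_half_mul_Upsilon_eq (w : ℝ) : Real.exp (-w / 2) * Upsilon w =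
    Real.exp (w / 2) - (1 + w) * Real.exp (-w / 2) := by
  have h : Real.exp w = Real.exp (w / 2) * Real.exp (w / 2) := by
    rw [← Real.exp_add]; congr 1; ring
  have h2 : Real.exp (-w / 2) * Real.exp (w / 2) = 1 := by
    rw [← Real.exp_add]; simp [neg_div]
  unfold Upsilon
  rw [h]
  linear_combination Real.exp (w / 2) * h2

theorem Upsilon_ge_quadratic {w : ℝ} (hw : 0 ≤ w) : w ^ 2 / 2 ≤ Upsilon w := by
  have := Real.quadratic_le_exp_of_nonneg hw
  unfold Upsilon
  linarith

/-- For large `w` the weighted function `e^{-w/2} Υ(w)` is of the order of `e^{w/2}`. -/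
theorem exp_half_le_of_two_le {w : ℝ} (hw : 2 ≤ w) :
    Real.exp (w / 2) / 4 ≤ Real.exp (-w / 2) * Upsilon w := by
  rw [exp_neg_half_mul_Upsilon_eq]
  have h1 := Real.quadratic_le_exp_of_nonneg (by linarith : 0 ≤ w)
  have h : Real.exp w * Real.exp (-w / 2) = Real.exp (w / 2) := by
    rw [← Real.exp_add]; congr 1; ring
  rw [← h]
  have h2 := mul_nonneg (Real.exp_pos (-w / 2)).le
    (by nlinarith : 0 ≤ 3 / 4 * Real.exp w - (1 + w))
  linarith

/-- The weighted function `e^{-w/2} Υ(w)` dominates every power `w^m` with `2 ≤ m`. -/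
theorem exists_pow_le_exp_mul_Upsilon {m : ℕ} (hm : 2 ≤ m) :
    ∃ c : ℝ, 0 < c ∧ ∀ w : ℝ, 0 ≤ w → c * w ^ m ≤ Real.exp (-w / 2) * Upsilon w := by
  refine ⟨min (Real.exp (-1) / 2 / 2 ^ (m - 2)) (1 / 4 / (2 ^ m * m.factorial)),
    by positivity, fun w hw => ?_⟩
  rcases le_total w 2 with h | h
  · have h1 : w ^ m ≤ w ^ 2 * 2 ^ (m - 2) := by
      obtain ⟨j, rfl⟩ := Nat.exists_eq_add_of_le hm
      rw [pow_add, Nat.add_sub_cancel_left]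
      gcongr
    have h2 : Real.exp (-1) ≤ Real.exp (-w / 2) := Real.exp_le_exp.2 (by linarith)
    calc _ ≤ Real.exp (-1) / 2 / 2 ^ (m - 2) * (w ^ 2 * 2 ^ (m - 2)) :=
          mul_le_mul (min_le_left _ _) h1 (by positivity) (by positivity)
      _ = Real.exp (-1) * (w ^ 2 / 2) := by field_simp
      _ ≤ _ := mul_le_mul h2 (Upsilon_ge_quadratic hw) (by positivity) (by positivity)
  · refine le_trans ?_ (exp_half_le_of_two_le h)
    have h1 := Real.pow_div_factorial_le_exp (w / 2) (by linarith) m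
    calc _ ≤ 1 / 4 / (2 ^ m * m.factorial) * w ^ m :=
          mul_le_mul_of_nonneg_right (min_le_right _ _) (by positivity)
      _ = (w / 2) ^ m / m.factorial / 4 := by rw [div_pow]; field_simp
      _ ≤ _ := by gcongr

/-- A form of Young's inequality: since `g(w) = e^{-w/2} Υ(w)` dominates `w^(n+1)`, `w` is controlled
by `s g(w)` up to an error of the order of `s^{-1/n}`, for every `s > 0`. -/
theorem exists_le_mul_add_rpow {n : ℕ} (hn : 1 ≤ n) : ∃ C : ℝ, 0 < C ∧ ∀ s w : ℝ, 0 < s →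
    w ≤ s * (Real.exp (-w / 2) * Upsilon w) + C * s ^ (-(1 / n : ℝ)) := by
  obtain ⟨c, hc, h⟩ := exists_pow_le_exp_mul_Upsilon (m := n + 1) (by omega)
  have hn0 : (n : ℝ) ≠ 0 := by positivity
  refine ⟨c ^ (-(1 / n : ℝ)), by positivity, fun s w hs => ?_⟩
  have hU : 0 ≤ s * (Real.exp (-w / 2) * Upsilon w) :=
    mul_nonneg hs.le (mul_nonneg (Real.exp_pos _).le (Upsilon_nonneg w))
  rw [← Real.mul_rpow hc.le hs.le]
  set t := (c * s) ^ (-(1 / n : ℝ)) with ht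
  have ht0 : 0 < t := by positivity
  rcases le_total w t with hwt | hwt
  · linarith
  · have hw : 0 < w := ht0.trans_le hwt
    -- `t` is the threshold above which `w ≤ s c w^(n+1)`
    have htn : t ^ n = (c * s)⁻¹ := by
      rw [ht, ← Real.rpow_natCast, ← Real.rpow_mul (by positivity)]
      rw [show -(1 / n : ℝ) * n = -1 by field_simp, Real.rpow_neg_one]
    have h1 : (c * s)⁻¹ ≤ w ^ n := htn ▸ pow_le_pow_left₀ ht0.le hwt n
    have h2 : 1 ≤ c * s * w ^ n := by
      rwa [inv_le_iff_one_le_mul₀' (by positivity)] at h1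
    have h3 := mul_le_mul_of_nonneg_left (h w hw.le) hs.le
    have h4 : w ≤ s * (c * w ^ (n + 1)) := by
      rw [pow_succ]
      nlinarith
    linarith

/-- `|D|` is controlled by `s Υ(D) + s⁻¹`, uniformly for `s ≥ 1`. -/
theorem abs_le_mul_Upsilon_add {s D : ℝ} (hs : 1 ≤ s) :
    |D| ≤ 4 * (s * Upsilon D + 1 / s) := by
  have hs0 : 0 < s := by linarith
  have hU := Upsilon_nonneg D
  have hinv : 0 < 1 / s := by positivity
  -- the lower bound for `Υ` is linear at `-∞` and quadratic near `0`
  have hquad : ∀ D : ℝ, -1 ≤ D → D ^ 2 / 4 ≤ Upsilon D := by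
    intro D hD
    have h1 := Real.add_one_le_exp (D / 2)
    have h2 : Real.exp D = Real.exp (D / 2) * Real.exp (D / 2) := by
      rw [← Real.exp_add]; congr 1; ring
    unfold Upsilon
    rw [h2]
    nlinarith
  rcases le_total (-1) D with h | h
  · have h1 := hquad D h
    have h2 : |D| ≤ s * D ^ 2 / 4 + 1 / s := by
      have h4 : 0 ≤ (s * |D| / 2 - 1) ^ 2 / s := by positivity
      have h5 : (s * |D| / 2 - 1) ^ 2 / s = s * |D| ^ 2 / 4 - |D| + 1 / s := by
        field_simp
        ring
      rw [h5, sq_abs] at h4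
      linarith
    nlinarith
  · have h1 : |D| / 4 ≤ Upsilon D := by
      rw [abs_of_nonpos (by linarith)]
      unfold Upsilon
      rcases le_total D (-4/3) with h6 | h6
      · linarith [Real.exp_pos D]
      · have := hquad D
        have h1 := Real.add_one_le_exp (D / 2)
        have h2 : Real.exp D = Real.exp (D / 2) * Real.exp (D / 2) := by
          rw [← Real.exp_add]; congr 1; ring
        rw [h2]
        nlinarith
    nlinarith

theorem mul_rpow_le_rpow_sub_rpow {b x : ℝ} (hx : 0 < x) (hb : 0 < b) :
    b * (x + 1) ^ (-b - 1) ≤ x ^ (-b) - (x + 1) ^ (-b) := by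
  have h1 : Real.log (x / (x + 1)) ≤ x / (x + 1) - 1 := Real.log_le_sub_one_of_pos (by positivity)
  have h2 : (x / (x + 1)) ^ (-b) = Real.exp (Real.log (x / (x + 1)) * (-b)) :=
    Real.rpow_def_of_pos (by positivity) _
  have h3 := Real.add_one_le_exp (Real.log (x / (x + 1)) * (-b))
  have h4 : x / (x + 1) - 1 = -(1 / (x + 1)) := by field_simp; ring
  have h5 : 1 + b / (x + 1) ≤ x ^ (-b) / (x + 1) ^ (-b) := by
    rw [← Real.div_rpow hx.le (by positivity), h2]
    rw [h4] at h1
    have h6 : b / (x + 1) = b * (1 / (x + 1)) := by ring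
    rw [h6]
    nlinarith
  rw [le_div_iff₀ (by positivity)] at h5
  rw [Real.rpow_sub_one (by positivity)]
  have h7 : b * ((x + 1) ^ (-b) / (x + 1)) = b / (x + 1) * (x + 1) ^ (-b) := by ring
  rw [h7]
  linarith

/-- The tail of a convergent `p`-series: `∑_{h > N} h^{-b-1} ≤ N^{-b} / b`. -/
theorem tsum_rpow_tail_le {b : ℝ} (hb : 0 < b) {N : ℕ} (hN : 1 ≤ N) :
    Summable (fun n : ℕ => ((n + N + 1 : ℕ) : ℝ) ^ (-b - 1)) ∧
      ∑' n : ℕ, ((n + N + 1 : ℕ) : ℝ) ^ (-b - 1) ≤ (N : ℝ) ^ (-b) / b := by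
  have hfin : ∀ M : ℕ, ∑ n ∈ Finset.range M, ((n + N + 1 : ℕ) : ℝ) ^ (-b - 1) ≤
      (N : ℝ) ^ (-b) / b := by
    intro M
    have h : ∑ n ∈ Finset.range M, ((n + N + 1 : ℕ) : ℝ) ^ (-b - 1) ≤
        ∑ n ∈ Finset.range M, (((n + N : ℕ) : ℝ) ^ (-b) / b - ((n + 1 + N : ℕ) : ℝ) ^ (-b) / b) := by
      refine Finset.sum_le_sum fun n _ => ?_
      have hpos : (0 : ℝ) < ((n + N : ℕ) : ℝ) := by exact_mod_cast (by omega : 0 < n + N)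
      have h1 := mul_rpow_le_rpow_sub_rpow hpos hb
      rw [← sub_div, le_div_iff₀ hb, mul_comm]
      rw [show ((n + 1 + N : ℕ) : ℝ) = ((n + N : ℕ) : ℝ) + 1 by push_cast; ring,
        show ((n + N + 1 : ℕ) : ℝ) = ((n + N : ℕ) : ℝ) + 1 by push_cast; ring]
      exact h1
    rw [Finset.sum_range_sub' (fun n : ℕ => ((n + N : ℕ) : ℝ) ^ (-b) / b)] at h
    have h2 : 0 ≤ ((M + N : ℕ) : ℝ) ^ (-b) / b := by positivity
    simp only [zero_add] at h
    linarith
  have hs : Summable (fun n : ℕ => ((n + N + 1 : ℕ) : ℝ) ^ (-b - 1)) :=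
    summable_of_sum_range_le (fun n => by positivity) hfin
  exact ⟨hs, hs.tsum_le_of_sum_range_le hfin⟩

theorem sum_rpow_le {a : ℝ} (ha : 0 < a) (ha1 : a ≤ 1) (N : ℕ) :
    ∑ n ∈ Finset.range N, ((n + 1 : ℕ) : ℝ) ^ (a - 1) ≤ (N : ℝ) ^ a / a := by
  induction N with
  | zero => simp [Real.zero_rpow ha.ne']
  | succ N ih =>
    rw [Finset.sum_range_succ]
    have hN : (0 : ℝ) < ((N + 1 : ℕ) : ℝ) := by positivity
    have h1 := rpow_one_add_le_one_add_mul_self (s := -(1 / ((N + 1 : ℕ) : ℝ)))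
      (by rw [neg_le_neg_iff, div_le_one hN]; push_cast; linarith [Nat.cast_nonneg (α := ℝ) N])
      ha.le ha1
    have h2 : 1 + -(1 / ((N + 1 : ℕ) : ℝ)) = (N : ℝ) / ((N + 1 : ℕ) : ℝ) := by
      field_simp
      push_cast
      ring
    rw [h2, Real.div_rpow (by positivity) hN.le, div_le_iff₀ (by positivity)] at h1
    rw [Real.rpow_sub_one hN.ne', le_div_iff₀ ha]
    rw [le_div_iff₀ ha] at ih
    have h3 : (1 + a * -(1 / ((N + 1 : ℕ) : ℝ))) * ((N + 1 : ℕ) : ℝ) ^ a =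
      ((N + 1 : ℕ) : ℝ) ^ a - ((N + 1 : ℕ) : ℝ) ^ a / ((N + 1 : ℕ) : ℝ) * a := by ring
    rw [h3] at h1
    rw [add_mul]
    linarith

/-! ### Lower bounds from the diagonal terms -/

/-- The sequence `k` on `{1, 2, …}`, with the value at `n + 1` stored at the index `n`, is comparable
to `(n + 1)^{-1-β}`. -/
structure IsPowerLike (β c C : ℝ) (k : ℕ → ℝ) : Prop where
  pos : 0 < c
  lower : ∀ n, c * ((n + 1 : ℕ) : ℝ) ^ (-1 - β) ≤ k n
  upper : ∀ n, k n ≤ C * ((n + 1 : ℕ) : ℝ) ^ (-1 - β)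

/-- `r = ∑ k_n w_n` and `∑ k_n² e^{-w_n/2} Υ(w_n) ≤ A`: what the diagonal terms of `Ψ_{2,Υ}`
retain of the function `u`, for `r = -L u(x)`. -/
structure DiagonalBound (k w : ℕ → ℝ) (r A : ℝ) : Prop where
  hasSum : HasSum (fun n => k n * w n) r
  summable : Summable (fun n => k n ^ 2 * (Real.exp (-w n / 2) * Upsilon (w n)))
  tsum_le : ∑' n, k n ^ 2 * (Real.exp (-w n / 2) * Upsilon (w n)) ≤ A

theorem exp_mul_Upsilon_nonneg (w : ℝ) : 0 ≤ Real.exp (-w / 2) * Upsilon w :=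
  mul_nonneg (Real.exp_pos _).le (Upsilon_nonneg w)

namespace IsPowerLike

variable {β c C : ℝ} {k : ℕ → ℝ}

theorem k_pos (hk : IsPowerLike β c C k) (n : ℕ) : 0 < k n :=
  lt_of_lt_of_le (mul_pos hk.pos (by positivity)) (hk.lower n)

theorem C_pos (hk : IsPowerLike β c C k) : 0 < C := by
  have h := (hk.k_pos 0).trans_le (hk.upper 0)
  simpa using h

end IsPowerLike

namespace DiagonalBound

variable {k w : ℕ → ℝ} {r A : ℝ}

theorem sum_le (h : DiagonalBound k w r A) (s : Finset ℕ) :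
    ∑ n ∈ s, k n ^ 2 * (Real.exp (-w n / 2) * Upsilon (w n)) ≤ A :=
  (h.summable.sum_le_tsum s fun _ _ =>
    mul_nonneg (sq_nonneg _) (exp_mul_Upsilon_nonneg _)).trans h.tsum_le

theorem single_le (h : DiagonalBound k w r A) (n : ℕ) :
    k n ^ 2 * (Real.exp (-w n / 2) * Upsilon (w n)) ≤ A := by
  simpa using h.sum_le {n}

theorem nonneg (h : DiagonalBound k w r A) : 0 ≤ A := by simpa using h.sum_le ∅

theorem head_add_tail (h : DiagonalBound k w r A) (N : ℕ) :
    ∑ n ∈ Finset.range N, k n * w n + ∑' n, k (n + N) * w (n + N) = r := by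
  rw [← h.hasSum.tsum_eq]
  exact h.hasSum.summable.sum_add_tsum_nat_add N

end DiagonalBound

/-- The part of `∑ k_n w_n` near the origin is controlled by the diagonal terms. -/
theorem exists_head_le {β c C : ℝ} {k : ℕ → ℝ} (hk : IsPowerLike β c C k) :
    ∃ K : ℝ, 0 < K ∧ ∀ w r A, DiagonalBound k w r A → ∀ (N : ℕ) (θ : ℝ), 0 < θ →
      ∑ n ∈ Finset.range N, k n * w n ≤ θ * A + K * (N / θ) := by
  obtain ⟨K, hK, hY⟩ := exists_le_mul_add_rpow (n := 1) le_rfl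
  refine ⟨K, hK, fun w r A h N θ hθ => ?_⟩
  have hterm : ∀ n, k n * w n ≤
      θ * (k n ^ 2 * (Real.exp (-w n / 2) * Upsilon (w n))) + K / θ := by
    intro n
    have hkn := hk.k_pos n
    have h1 := mul_le_mul_of_nonneg_left (hY (θ * k n) (w n) (by positivity)) hkn.le
    refine h1.trans (le_of_eq ?_)
    rw [Nat.cast_one, div_one, Real.rpow_neg_one]
    field_simp
  calc _ ≤ ∑ n ∈ Finset.range N,
        (θ * (k n ^ 2 * (Real.exp (-w n / 2) * Upsilon (w n))) + K / θ) :=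
        Finset.sum_le_sum fun n _ => hterm n
    _ = θ * ∑ n ∈ Finset.range N, k n ^ 2 * (Real.exp (-w n / 2) * Upsilon (w n))
        + K * (N / θ) := by
        rw [Finset.sum_add_distrib, ← Finset.mul_sum, Finset.sum_const, Finset.card_range,
          nsmul_eq_mul]
        ring
    _ ≤ _ := by
        have := mul_le_mul_of_nonneg_left (h.sum_le (Finset.range N)) hθ.le
        linarith

/-- The tail of `∑ k_n w_n` is controlled by the diagonal terms, with an arbitrarily small power
`η = 1 / m` of the Young parameter `θ`. -/
theorem exists_tail_le {β c C : ℝ} {k : ℕ → ℝ} (hk : IsPowerLike β c C k) {m : ℕ} (hm : 1 ≤ m)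
    {b : ℝ} (hb : 0 < b) (hbm : b = (1 + β) * (1 - 1 / m) - 1) :
    ∃ K : ℝ, 0 < K ∧ ∀ w r A, DiagonalBound k w r A → ∀ (N : ℕ) (θ : ℝ), 1 ≤ N → 0 < θ →
      ∑' n, k (n + N) * w (n + N) ≤ θ * A + K * (θ ^ (-(1 / m : ℝ)) * (N : ℝ) ^ (-b)) := by
  obtain ⟨K, hK, hY⟩ := exists_le_mul_add_rpow hm
  have hC := hk.C_pos
  have hm1 : (1 : ℝ) / m ≤ 1 := by
    rw [div_le_one (by positivity)]
    exact_mod_cast hm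
  refine ⟨K * C ^ (1 - 1 / m : ℝ) / b, by positivity, fun w r A h N θ hN hθ => ?_⟩
  set G : ℕ → ℝ := fun n => k n ^ 2 * (Real.exp (-w n / 2) * Upsilon (w n)) with hG
  have hG0 : ∀ n, 0 ≤ G n := fun n => mul_nonneg (sq_nonneg _) (exp_mul_Upsilon_nonneg _)
  have hterm : ∀ n, k (n + N) * w (n + N) ≤ θ * G (n + N) +
      K * θ ^ (-(1 / m : ℝ)) * C ^ (1 - 1 / m : ℝ) * ((n + N + 1 : ℕ) : ℝ) ^ (-b - 1) := by
    intro n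
    have hkn := hk.k_pos (n + N)
    have h1 := mul_le_mul_of_nonneg_left (hY (θ * k (n + N)) (w (n + N)) (by positivity)) hkn.le
    have h2 : k (n + N) * k (n + N) ^ (-(1 / m : ℝ)) = k (n + N) ^ (1 - 1 / m : ℝ) := by
      rw [sub_eq_add_neg, Real.rpow_add hkn, Real.rpow_one]
    have h3 : k (n + N) ^ (1 - 1 / m : ℝ) ≤
        C ^ (1 - 1 / m : ℝ) * ((n + N + 1 : ℕ) : ℝ) ^ (-b - 1) := by
      have h4 := Real.rpow_le_rpow hkn.le (hk.upper (n + N)) (by linarith : (0 : ℝ) ≤ 1 - 1 / m)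
      rw [Real.mul_rpow hC.le (by positivity), ← Real.rpow_mul (by positivity)] at h4
      rwa [show -b - 1 = (-1 - β) * (1 - 1 / m) by rw [hbm]; ring]
    rw [mul_add, Real.mul_rpow hθ.le hkn.le] at h1
    calc _ ≤ _ := h1
      _ = θ * G (n + N) +
          K * θ ^ (-(1 / m : ℝ)) * (k (n + N) * k (n + N) ^ (-(1 / m : ℝ))) := by
          simp only [hG]; ring
      _ ≤ _ := by
          rw [h2, mul_assoc (K * _)]
          gcongr
  obtain ⟨hs, hle⟩ := tsum_rpow_tail_le hb hN
  have hGs : Summable (fun n => G (n + N)) := (summable_nat_add_iff N).2 h.summable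
  have hkw : Summable (fun n => k (n + N) * w (n + N)) :=
    (summable_nat_add_iff N).2 h.hasSum.summable
  have h5 := hkw.tsum_le_tsum hterm ((hGs.mul_left _).add (hs.mul_left _))
  rw [(hGs.mul_left _).tsum_add (hs.mul_left _), tsum_mul_left, tsum_mul_left] at h5
  have h6 : ∑' n, G (n + N) ≤ A := by
    refine le_trans ?_ h.tsum_le
    have h7 := h.summable.sum_add_tsum_nat_add N
    have h8 := Finset.sum_nonneg fun n (_ : n ∈ Finset.range N) => hG0 n
    simp only [hG] at h8 ⊢
    linarith
  calc _ ≤ _ := h5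
    _ ≤ θ * A + K * θ ^ (-(1 / m : ℝ)) * C ^ (1 - 1 / m : ℝ) * ((N : ℝ) ^ (-b) / b) := by
        gcongr
    _ = _ := by ring

/-- Optimisation over the cut-off `N`. -/
theorem rpow_le_of_forall_le {C a b r A : ℝ} (hC : 0 < C) (ha : 0 < a) (hb : 0 < b) (hr : 0 < r)
    (hrC : r ≤ 2 * C)
    (h : ∀ N : ℕ, 1 ≤ N → r ≤ C * ((N : ℝ) ^ a * A + (N : ℝ) ^ (-b))) :
    (2 : ℝ) ^ (-a) * (r / (2 * C)) ^ (1 + a / b) ≤ A := by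
  set x := (2 * C / r) ^ (1 / b) with hx
  have hx1 : 1 ≤ x := Real.one_le_rpow (by rwa [one_le_div hr]) (by positivity)
  have hx0 : 0 < x := by linarith
  have hxN := Nat.le_ceil x
  set N := ⌈x⌉₊ with hN
  have hN2 : (N : ℝ) ≤ 2 * x := by
    have := Nat.ceil_lt_add_one hx0.le
    linarith
  have hN0 : (0 : ℝ) < N := hx0.trans_le hxN
  have h1 := h N (by exact_mod_cast hN0)
  have h2 : (N : ℝ) ^ (-b) ≤ r / (2 * C) := by
    calc (N : ℝ) ^ (-b) ≤ x ^ (-b) := Real.rpow_le_rpow_of_nonpos hx0 hxN (by linarith)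
      _ = r / (2 * C) := by
        rw [hx, ← Real.rpow_mul (by positivity),
          show 1 / b * -b = -1 by field_simp, Real.rpow_neg_one, inv_div]
  have h3 : r / 2 ≤ C * ((N : ℝ) ^ a * A) := by
    have h4 := mul_le_mul_of_nonneg_left h2 hC.le
    have h5 : C * (r / (2 * C)) = r / 2 := by field_simp
    linarith
  have hA : 0 < A := by
    by_contra hA
    have : (N : ℝ) ^ a * A ≤ 0 := mul_nonpos_of_nonneg_of_nonpos (by positivity) (by linarith)
    nlinarith
  have h6 : (N : ℝ) ^ a ≤ 2 ^ a * (r / (2 * C)) ^ (-(a / b)) := by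
    calc (N : ℝ) ^ a ≤ (2 * x) ^ a := Real.rpow_le_rpow hN0.le hN2 ha.le
      _ = _ := by
        rw [Real.mul_rpow (by norm_num) hx0.le, hx, ← Real.rpow_mul (by positivity),
          Real.rpow_neg (by positivity), ← Real.inv_rpow (by positivity), inv_div,
          one_div_mul_eq_div]
  have h7 : r / (2 * C) ≤ 2 ^ a * (r / (2 * C)) ^ (-(a / b)) * A := by
    have h8 : r / (2 * C) ≤ (N : ℝ) ^ a * A := by
      rw [div_le_iff₀ (by positivity)]
      linarith
    exact h8.trans (mul_le_mul_of_nonneg_right h6 hA.le)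
  have h9 : 0 < (2 : ℝ) ^ a := by positivity
  have h10 : 0 < (r / (2 * C)) ^ (a / b) := by positivity
  rw [Real.rpow_neg (by positivity)] at h7 ⊢
  rw [Real.rpow_add (by positivity), Real.rpow_one]
  calc _ ≤ (2 ^ a)⁻¹ * ((2 ^ a * ((r / (2 * C)) ^ (a / b))⁻¹ * A) * (r / (2 * C)) ^ (a / b)) := by
        gcongr
    _ = A := by field_simp

theorem exists_rpow_le_of_forall_le {S : ℝ → ℝ → Prop} {K a b : ℝ} (hK : 0 < K) (ha : 0 < a)
    (hb : 0 < b) (hA : ∀ r A, S r A → 0 ≤ A)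
    (h : ∀ r A, S r A → ∀ N : ℕ, 1 ≤ N → r ≤ K * ((N : ℝ) ^ a * A + (N : ℝ) ^ (-b))) (R : ℝ) :
    ∃ c' : ℝ, 0 < c' ∧ ∀ r A, S r A → 0 < r → r ≤ R → c' * r ^ (1 + a / b) ≤ A := by
  set M := max K R with hM
  have hM0 : 0 < M := hK.trans_le (le_max_left _ _)
  refine ⟨2 ^ (-a) / (2 * M) ^ (1 + a / b), by positivity, fun r A hS hr hrR => ?_⟩
  have hrM : r ≤ 2 * M := by linarith [le_max_right K R]
  have h1 := rpow_le_of_forall_le hM0 ha hb hr hrM (A := A) fun N hN => by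
    refine (h r A hS N hN).trans (mul_le_mul_of_nonneg_right (le_max_left _ _) ?_)
    have := hA r A hS
    positivity
  rw [Real.div_rpow hr.le (by positivity)] at h1
  calc _ = 2 ^ (-a) * (r ^ (1 + a / b) / (2 * M) ^ (1 + a / b)) := by ring
    _ ≤ A := h1

/-- The diagonal terms alone give the power `2 + 1 / β` on bounded intervals. -/
theorem exists_rpow_le_of_diagonal {β c C : ℝ} {k : ℕ → ℝ} (hβ : 0 < β)
    (hk : IsPowerLike β c C k) (R : ℝ) :
    ∃ c' : ℝ, 0 < c' ∧ ∀ r A, (∃ w, DiagonalBound k w r A) → 0 < r → r ≤ R →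
      c' * r ^ ((1 + 2 * β) / β) ≤ A := by
  obtain ⟨m, hm⟩ := exists_nat_gt ((1 + β) / β)
  have hm0 : (0 : ℝ) < m := lt_trans (by positivity) hm
  have hm1 : 1 ≤ m := by exact_mod_cast hm0
  set b := (1 + β) * (1 - 1 / m) - 1 with hb
  have hb0 : 0 < b := by
    have h1 : (1 + β) * (1 / m) < β := by
      rw [mul_one_div, div_lt_iff₀ hm0]
      rwa [div_lt_iff₀ hβ, mul_comm] at hm
    linarith
  obtain ⟨K₁, hK₁, h₁⟩ := exists_head_le hk
  obtain ⟨K₂, hK₂, h₂⟩ := exists_tail_le hk hm1 hb0 hb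
  have hexp : (1 + 2 * β) / β = 1 + (1 + β) / β := by field_simp; ring
  rw [hexp]
  refine exists_rpow_le_of_forall_le (K := 2 + K₁ + K₂) (by positivity) (by positivity) hβ
    (fun r A ⟨w, h⟩ => h.nonneg) (fun r A ⟨w, h⟩ N hN => ?_) R
  have hN0 : (0 : ℝ) < N := by exact_mod_cast hN
  have hθ : 0 < (N : ℝ) ^ (1 + β) := by positivity
  have e1 := h₁ w r A h N _ hθ
  have e2 := h₂ w r A h N _ hN hθ
  have f1 : (N : ℝ) / (N : ℝ) ^ (1 + β) = (N : ℝ) ^ (-β) := by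
    rw [Real.rpow_add hN0, Real.rpow_neg hN0.le, Real.rpow_one]
    field_simp
  have f2 : ((N : ℝ) ^ (1 + β)) ^ (-(1 / m : ℝ)) * (N : ℝ) ^ (-b) = (N : ℝ) ^ (-β) := by
    rw [← Real.rpow_mul hN0.le, ← Real.rpow_add hN0, hb]
    congr 1
    ring
  rw [f1] at e1
  rw [f2] at e2
  rw [← h.head_add_tail N]
  have := h.nonneg
  have g1 : 0 ≤ (N : ℝ) ^ (1 + β) * A := by positivity
  have g2 : 0 ≤ (N : ℝ) ^ (-β) := by positivity
  nlinarith [mul_nonneg hK₁.le g1, mul_nonneg hK₂.le g1]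

/-- For large `r` the diagonal terms grow exponentially: at some index `w_n` is at least a
multiple of `r (1 + log (n + 1))`, and the logarithm compensates the decay of `k_n²`. -/
theorem exists_exp_le_of_diagonal {β c C : ℝ} {k : ℕ → ℝ} (hβ : 0 < β)
    (hk : IsPowerLike β c C k) :
    ∃ R c' ν : ℝ, 0 < R ∧ 0 < c' ∧ 0 < ν ∧ ∀ r A, (∃ w, DiagonalBound k w r A) → R ≤ r →
      c' * Real.exp (ν * r) ≤ A := by
  set l : ℕ → ℝ := fun n => 1 + Real.log ((n + 1 : ℕ) : ℝ) with hl
  have hlog : ∀ n : ℕ, 0 ≤ Real.log ((n + 1 : ℕ) : ℝ) := fun n =>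
    Real.log_nonneg (by exact_mod_cast Nat.le_add_left 1 n)
  have hl1 : ∀ n, 1 ≤ l n := fun n => by simp only [hl]; linarith [hlog n]
  have hC := hk.C_pos
  have hs : Summable (fun n => k n * l n) := by
    have h1 : Summable (fun n : ℕ => C * (1 + 1 / (β / 2)) *
        ((n + 1 : ℕ) : ℝ) ^ (-(β / 2) - 1)) := by
      refine Summable.mul_left _ ?_
      exact (summable_nat_add_iff (f := fun n : ℕ => ((n : ℕ) : ℝ) ^ (-(β / 2) - 1)) 1).2
        (Real.summable_nat_rpow.2 (by linarith))
    refine Summable.of_nonneg_of_le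
      (fun n => mul_nonneg (hk.k_pos n).le (zero_le_one.trans (hl1 n))) (fun n => ?_) h1
    have hn : (1 : ℝ) ≤ ((n + 1 : ℕ) : ℝ) := by exact_mod_cast Nat.le_add_left 1 n
    have hn0 : (0 : ℝ) < ((n + 1 : ℕ) : ℝ) := by linarith
    have h2 : l n ≤ (1 + 1 / (β / 2)) * ((n + 1 : ℕ) : ℝ) ^ (β / 2) := by
      have h3 := Real.log_le_rpow_div hn0.le (by positivity : 0 < β / 2)
      have h4 := Real.one_le_rpow hn (by positivity : 0 ≤ β / 2)
      have h5 : ((n + 1 : ℕ) : ℝ) ^ (β / 2) / (β / 2) =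
        1 / (β / 2) * ((n + 1 : ℕ) : ℝ) ^ (β / 2) := by ring
      simp only [hl]
      linarith
    calc k n * l n ≤ (C * ((n + 1 : ℕ) : ℝ) ^ (-1 - β)) *
          ((1 + 1 / (β / 2)) * ((n + 1 : ℕ) : ℝ) ^ (β / 2)) :=
          mul_le_mul (hk.upper n) h2 (zero_le_one.trans (hl1 n)) (by positivity)
      _ = C * (1 + 1 / (β / 2)) *
          (((n + 1 : ℕ) : ℝ) ^ (-1 - β) * ((n + 1 : ℕ) : ℝ) ^ (β / 2)) := by ring
      _ = _ := by
          rw [← Real.rpow_add hn0]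
          congr 2
          ring
  set K := ∑' n, k n * l n with hK
  have hK0 : 0 < K :=
    hs.tsum_pos (fun n => mul_nonneg (hk.k_pos n).le (zero_le_one.trans (hl1 n))) 0
      (mul_pos (hk.k_pos 0) (zero_lt_one.trans_le (hl1 0)))
  refine ⟨2 * K * (4 * (1 + β)), c ^ 2 / 4, 1 / (4 * K), by positivity,
    by have := hk.pos; positivity, by positivity, fun r A ⟨w, h⟩ hr => ?_⟩
  have hr0 : 0 < r := lt_of_lt_of_le (by positivity) hr
  set ρ := r / (2 * K) with hρ
  have hρ0 : 4 * (1 + β) ≤ ρ := by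
    rw [hρ, le_div_iff₀ (by positivity)]
    linarith
  -- otherwise `r ≤ ρ K = r / 2`
  obtain ⟨n, hn⟩ : ∃ n, ρ * l n < w n := by
    by_contra! hcon
    have h1 : r ≤ ρ * K := by
      rw [← h.hasSum.tsum_eq, hK, ← tsum_mul_left]
      refine h.hasSum.summable.tsum_le_tsum (fun n => ?_) (hs.mul_left _)
      have := mul_le_mul_of_nonneg_left (hcon n) (hk.k_pos n).le
      linarith
    have h2 : ρ * K = r / 2 := by rw [hρ]; field_simp
    linarith
  have hw2 : 2 ≤ w n := by
    have : ρ * 1 ≤ ρ * l n := mul_le_mul_of_nonneg_left (hl1 n) (by linarith)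
    linarith
  refine le_trans ?_ (h.single_le n)
  have hn0 : (0 : ℝ) < ((n + 1 : ℕ) : ℝ) := by positivity
  have h1 : c * ((n + 1 : ℕ) : ℝ) ^ (-1 - β) ≤ k n := hk.lower n
  have h2 : Real.exp (ρ / 2) ≤ (((n + 1 : ℕ) : ℝ) ^ (-1 - β)) ^ 2 * Real.exp (w n / 2) := by
    rw [Real.rpow_def_of_pos hn0, ← Real.exp_nat_mul, ← Real.exp_add]
    refine Real.exp_le_exp.2 ?_
    have h3 : ρ * (1 + Real.log ((n + 1 : ℕ) : ℝ)) < w n := hn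
    have h4 := mul_le_mul_of_nonneg_right hρ0 (hlog n)
    push_cast at h3 h4 ⊢
    linarith
  have h5 := exp_half_le_of_two_le hw2
  have hc := hk.pos
  calc c ^ 2 / 4 * Real.exp (1 / (4 * K) * r) = c ^ 2 / 4 * Real.exp (ρ / 2) := by
        congr 2
        rw [hρ]
        field_simp
        norm_num
    _ ≤ c ^ 2 / 4 * ((((n + 1 : ℕ) : ℝ) ^ (-1 - β)) ^ 2 * Real.exp (w n / 2)) := by gcongr
    _ = (c * ((n + 1 : ℕ) : ℝ) ^ (-1 - β)) ^ 2 * (Real.exp (w n / 2) / 4) := by ring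
    _ ≤ _ := by gcongr

/-! ### Lower bounds from the terms with one unit step -/

/-- The second difference `v(j + 1) - v(j) - v(1)`, for a function with `v(0) = 0`. -/
def unitDefect (v : ℤ → ℝ) (j : ℤ) : ℝ := v (j + 1) - v j - v 1

/-- The symmetric part `-(v(h) + v(-h))`, `h = n + 1`, is a sum of second differences with
step `1`. -/
theorem neg_symm_part_le_sum {v : ℤ → ℝ} (hv : v 0 = 0) (n : ℕ) :
    -v (n + 1) - v (-(n + 1)) ≤ ∑ i ∈ Finset.range (n + 1),
      (|unitDefect v (i + 1)| + |unitDefect v (-(i + 1))|) := by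
  have h : -v (n + 1) - v (-(n + 1)) ≤ ∑ i ∈ Finset.range n, |unitDefect v (i + 1)| +
      ∑ i ∈ Finset.range (n + 1), |unitDefect v (-(i + 1))| := by
    induction n with
    | zero =>
      have e : unitDefect v (-(0 + 1)) = -v 1 - v (-1) := by
        unfold unitDefect
        norm_num [hv]
        ring
      simp only [Finset.range_zero, Finset.sum_empty, zero_add, Finset.sum_range_one,
        Nat.cast_zero]
      rw [zero_add] at e
      rw [← e]
      exact le_abs_self _
    | succ n ih =>
      rw [Finset.sum_range_succ _ n, Finset.sum_range_succ _ (n + 1)]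
      have e1 : unitDefect v (n + 1) = v ((n + 1 : ℕ) + 1) - v (n + 1) - v 1 := by
        unfold unitDefect
        push_cast
        rfl
      have e2 : unitDefect v (-((n + 1 : ℕ) + 1)) =
          v (-(n + 1)) - v (-((n + 1 : ℕ) + 1)) - v 1 := by
        unfold unitDefect
        rw [show -(((n + 1 : ℕ) : ℤ) + 1) + 1 = -(n + 1) by push_cast; ring]
      have h1 := neg_abs_le (unitDefect v (n + 1))
      have h2 := le_abs_self (unitDefect v (-((n + 1 : ℕ) + 1)))
      linarith
  refine h.trans ?_
  rw [Finset.sum_add_distrib, Finset.sum_range_succ _ n]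
  have := abs_nonneg (unitDefect v (n + 1))
  linarith [Finset.sum_range_succ (fun i : ℕ => |unitDefect v (i + 1)|) n]

/-- The sums `∑_{i ≤ n < N} k_n` are of the order of `(i + 1)^{-β}`. -/
theorem IsPowerLike.sum_Ico_le {β c C : ℝ} {k : ℕ → ℝ} (hβ : 0 < β) (hk : IsPowerLike β c C k)
    (i N : ℕ) :
    ∑ n ∈ Finset.Ico i N, k n ≤ C * (1 + 1 / β) * ((i + 1 : ℕ) : ℝ) ^ (-β) := by
  have hC := hk.C_pos
  have hi : (1 : ℝ) ≤ ((i + 1 : ℕ) : ℝ) := by exact_mod_cast Nat.le_add_left 1 i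
  rcases le_or_gt N i with h | h
  · rw [Finset.Ico_eq_empty (by omega), Finset.sum_empty]
    positivity
  · rw [Finset.sum_eq_sum_Ico_succ_bot h, Finset.sum_Ico_eq_sum_range]
    obtain ⟨hs, hle⟩ := tsum_rpow_tail_le hβ (N := i + 1) (by omega)
    have h1 : ∑ n ∈ Finset.range (N - (i + 1)), k (i + 1 + n) ≤
        C * (((i + 1 : ℕ) : ℝ) ^ (-β) / β) := by
      calc _ ≤ ∑ n ∈ Finset.range (N - (i + 1)), C * ((n + (i + 1) + 1 : ℕ) : ℝ) ^ (-β - 1) := by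
            refine Finset.sum_le_sum fun n _ => ?_
            rw [show i + 1 + n = n + (i + 1) by ring, show -β - 1 = -1 - β by ring]
            exact hk.upper _
        _ ≤ C * (((i + 1 : ℕ) : ℝ) ^ (-β) / β) := by
            rw [← Finset.mul_sum]
            exact mul_le_mul_of_nonneg_left
              ((hs.sum_le_tsum _ fun _ _ => by positivity).trans hle) hC.le
    have h2 : k i ≤ C * ((i + 1 : ℕ) : ℝ) ^ (-β) := by
      refine (hk.upper i).trans (mul_le_mul_of_nonneg_left ?_ hC.le)
      exact Real.rpow_le_rpow_of_exponent_le hi (by linarith)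
    calc _ ≤ C * ((i + 1 : ℕ) : ℝ) ^ (-β) + C * (((i + 1 : ℕ) : ℝ) ^ (-β) / β) := add_le_add h2 h1
      _ = _ := by ring

/-- The part of `∑ k_n w_n` near the origin is controlled by the terms of `Ψ_{2,Υ}` with one
increment equal to `1`. For `β < 2` the gain over the diagonal terms is that `N²` replaces
`N^{1+β}` if `β > 1`. -/
theorem exists_head_le_of_unitDefect {β c C : ℝ} {k : ℕ → ℝ} (hβ : 1 ≤ β) (hβ₂ : β < 2)
    (hk : IsPowerLike β c C k) :
    ∃ K : ℝ, 0 < K ∧ ∀ (v : ℤ → ℝ) (A : ℝ) (N : ℕ), v 0 = 0 → 1 ≤ N →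
      ∑ n ∈ Finset.range N, k n *
        (Upsilon (unitDefect v (n + 1)) + Upsilon (unitDefect v (-(n + 1)))) ≤ A →
      ∑ n ∈ Finset.range N, k n * (-v (n + 1) - v (-(n + 1))) ≤
        K * ((N : ℝ) ^ (2 : ℝ) * A + (N : ℝ) ^ (-β)) := by
  have hC := hk.C_pos
  have hc := hk.pos
  set M := 4 * (C * (1 + 1 / β)) with hM
  have hM0 : 0 < M := by positivity
  have h2β : 0 < 2 - β := by linarith
  refine ⟨M * (1 / c + 2 / (2 - β)), by positivity, fun v A N hv hN hA => ?_⟩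
  have hN0 : (0 : ℝ) < N := by exact_mod_cast hN
  set d : ℕ → ℝ := fun i => |unitDefect v (i + 1)| + |unitDefect v (-(i + 1))| with hd
  set U : ℕ → ℝ := fun i => Upsilon (unitDefect v (i + 1)) + Upsilon (unitDefect v (-(i + 1)))
    with hU
  have hd0 : ∀ i, 0 ≤ d i := fun i => add_nonneg (abs_nonneg _) (abs_nonneg _)
  have hU0 : ∀ i, 0 ≤ U i := fun i => add_nonneg (Upsilon_nonneg _) (Upsilon_nonneg _)
  have hswap : ∑ n ∈ Finset.range N, k n * (-v (n + 1) - v (-(n + 1))) ≤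
      ∑ i ∈ Finset.range N, (∑ n ∈ Finset.Ico i N, k n) * d i := by
    calc _ ≤ ∑ n ∈ Finset.range N, ∑ i ∈ Finset.range (n + 1), k n * d i := by
          refine Finset.sum_le_sum fun n _ => ?_
          rw [← Finset.mul_sum]
          exact mul_le_mul_of_nonneg_left (neg_symm_part_le_sum hv n) (hk.k_pos n).le
      _ = ∑ i ∈ Finset.range N, ∑ n ∈ Finset.Ico i N, k n * d i := by
          refine Finset.sum_comm' fun n i => ?_
          simp only [Finset.mem_range, Finset.mem_Ico]
          omega
      _ = _ := by simp only [Finset.sum_mul]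
  have hterm : ∀ i ∈ Finset.range N, (∑ n ∈ Finset.Ico i N, k n) * d i ≤
      M * ((N : ℝ) ^ (2 : ℝ) / c * (k i * U i) +
        2 / (N : ℝ) ^ (2 : ℝ) * ((i + 1 : ℕ) : ℝ) ^ ((2 - β) - 1)) := by
    intro i hi
    have hi0 : (0 : ℝ) < ((i + 1 : ℕ) : ℝ) := by positivity
    have hiN : ((i + 1 : ℕ) : ℝ) ≤ N := by exact_mod_cast Finset.mem_range.1 hi
    set s := (N : ℝ) ^ (2 : ℝ) / ((i + 1 : ℕ) : ℝ) with hs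
    have hs1 : 1 ≤ s := by
      rw [hs, one_le_div hi0, Real.rpow_two]
      have : (1 : ℝ) ≤ N := by exact_mod_cast hN
      nlinarith
    have h1 : d i ≤ 4 * (s * U i + 2 / s) := by
      have e1 := abs_le_mul_Upsilon_add (D := unitDefect v (i + 1)) hs1
      have e2 := abs_le_mul_Upsilon_add (D := unitDefect v (-(i + 1))) hs1
      simp only [hd, hU]
      calc _ ≤ _ := add_le_add e1 e2
        _ = _ := by ring
    have h2 := hk.sum_Ico_le (by linarith) i N
    have h3 : c * (((i + 1 : ℕ) : ℝ) ^ (-β) / ((i + 1 : ℕ) : ℝ)) ≤ k i := by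
      rw [← Real.rpow_sub_one hi0.ne', show -β - 1 = -1 - β by ring]
      exact hk.lower i
    have hs0 : 0 < s := by linarith
    calc _ ≤ (C * (1 + 1 / β) * ((i + 1 : ℕ) : ℝ) ^ (-β)) * (4 * (s * U i + 2 / s)) :=
          mul_le_mul h2 h1 (hd0 i) (by positivity)
      _ = M * ((N : ℝ) ^ (2 : ℝ) / c * (c * (((i + 1 : ℕ) : ℝ) ^ (-β) / ((i + 1 : ℕ) : ℝ)) * U i) +
        2 / (N : ℝ) ^ (2 : ℝ) * (((i + 1 : ℕ) : ℝ) ^ (-β) * ((i + 1 : ℕ) : ℝ))) := by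
          rw [hM, hs]
          field_simp
      _ ≤ _ := by
          rw [← Real.rpow_add_one hi0.ne', show -β + 1 = 2 - β - 1 by ring]
          have := mul_le_mul_of_nonneg_right h3 (hU0 i)
          gcongr
  calc _ ≤ _ := hswap
    _ ≤ _ := Finset.sum_le_sum hterm
    _ = M * ((N : ℝ) ^ (2 : ℝ) / c * ∑ i ∈ Finset.range N, k i * U i +
        2 / (N : ℝ) ^ (2 : ℝ) * ∑ i ∈ Finset.range N, ((i + 1 : ℕ) : ℝ) ^ ((2 - β) - 1)) := by
        rw [← Finset.mul_sum, Finset.sum_add_distrib, ← Finset.mul_sum, ← Finset.mul_sum]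
    _ ≤ M * ((N : ℝ) ^ (2 : ℝ) / c * A +
        2 / (N : ℝ) ^ (2 : ℝ) * ((N : ℝ) ^ (2 - β) / (2 - β))) := by
        have := sum_rpow_le h2β (by linarith : 2 - β ≤ 1) N
        gcongr
    _ = M * (1 / c * ((N : ℝ) ^ (2 : ℝ) * A) + 2 / (2 - β) * (N : ℝ) ^ (-β)) := by
        rw [show (2 - β) = 2 + -β by ring, Real.rpow_add hN0]
        field_simp
    _ ≤ _ := by
        have hA0 : 0 ≤ A := le_trans (Finset.sum_nonneg fun i _ =>
          mul_nonneg (hk.k_pos i).le (hU0 i)) hA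
        have g1 : 0 ≤ (N : ℝ) ^ (2 : ℝ) * A := by positivity
        have g2 : 0 ≤ (N : ℝ) ^ (-β) := by positivity
        rw [mul_assoc M]
        refine mul_le_mul_of_nonneg_left ?_ hM0.le
        have g3 : 0 ≤ 1 / c * (N : ℝ) ^ (-β) := by positivity
        have g4 : 0 ≤ 2 / (2 - β) * ((N : ℝ) ^ (2 : ℝ) * A) := by positivity
        linarith

/-- What the diagonal terms and the terms with one increment equal to `1` retain of a function `v`
with `v(0) = 0`. The latter carry the weight `e^{v(1)}`, which is bounded below by a constant if
`A` is bounded; this constant is part of `κ`. -/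
structure UnitStepBound (k : ℕ → ℝ) (κ : ℝ) (v : ℤ → ℝ) (r A : ℝ) : Prop where
  map_zero : v 0 = 0
  diagonal : DiagonalBound k (fun n => -v (n + 1) - v (-(n + 1))) r A
  unit_step : A ≤ 1 → ∀ N : ℕ, ∑ n ∈ Finset.range N, k n *
    (Upsilon (unitDefect v (n + 1)) + Upsilon (unitDefect v (-(n + 1)))) ≤ κ * A

/-- For `β > 1`, combining the terms with one increment equal to `1` near the origin and the
diagonal terms away from the origin gives the power `β / (β - 1)` on bounded intervals. -/
theorem exists_rpow_le_of_unitStep {β c C κ : ℝ} {k : ℕ → ℝ} (hβ : 1 < β) (hβ₂ : β < 2)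
    (hκ : 0 < κ) (hk : IsPowerLike β c C k) {R : ℝ} (hR : 0 < R) :
    ∃ c' : ℝ, 0 < c' ∧ ∀ r A, (∃ v, UnitStepBound k κ v r A) → 0 < r → r ≤ R →
      c' * r ^ (β / (β - 1)) ≤ A := by
  have hβ0 : 0 < β := by linarith
  have hβ1 : 0 < β - 1 := by linarith
  have h2β : 0 < 2 - β := by linarith
  -- the Young exponent `η = 1 / m` has to be small
  obtain ⟨m, hm⟩ := exists_nat_gt (max ((1 + β) / β) ((β - 1) / (2 - β)))
  obtain ⟨hma, hmb⟩ := max_lt_iff.1 hm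
  have hm0 : (0 : ℝ) < m := lt_trans (by positivity) hma
  have hm1 : 1 ≤ m := by exact_mod_cast hm0
  set b := (1 + β) * (1 - 1 / m) - 1 with hb
  have hb0 : 0 < b := by
    have h1 : (1 + β) * (1 / m) < β := by
      rw [mul_one_div, div_lt_iff₀ hm0]
      rwa [div_lt_iff₀ hβ0, mul_comm] at hma
    linarith
  set b' := β - (β - 1) / m with hb'
  have hm2 : (β - 1) / m ≤ 2 - β := by
    rw [div_le_iff₀ hm0]
    rw [div_lt_iff₀ h2β] at hmb
    linarith
  have hb'0 : 0 < b' := by linarith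
  obtain ⟨K₁, hK₁, h₁⟩ := exists_head_le_of_unitDefect hβ.le hβ₂ hk
  obtain ⟨K₂, hK₂, h₂⟩ := exists_tail_le hk hm1 hb0 hb
  have hmain : ∃ c' : ℝ, 0 < c' ∧ ∀ r A, (A ≤ 1 ∧ ∃ v, UnitStepBound k κ v r A) → 0 < r →
      r ≤ R → c' * r ^ (1 + 2 / b') ≤ A := by
    refine exists_rpow_le_of_forall_le (K := 1 + K₁ * κ + K₁ + K₂) (by positivity) (by norm_num)
      hb'0 (fun r A ⟨_, w, h⟩ => h.diagonal.nonneg) (fun r A ⟨hA1, v, h⟩ N hN => ?_) R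
    have hN0 : (0 : ℝ) < N := by exact_mod_cast hN
    have hA0 := h.diagonal.nonneg
    have e1 := h₁ v (κ * A) N h.map_zero hN (h.unit_step hA1 N)
    have e2 := h₂ _ r A h.diagonal N ((N : ℝ) ^ (2 : ℝ)) hN (by positivity)
    have f2 : ((N : ℝ) ^ (2 : ℝ)) ^ (-(1 / m : ℝ)) * (N : ℝ) ^ (-b) = (N : ℝ) ^ (-b') := by
      rw [← Real.rpow_mul hN0.le, ← Real.rpow_add hN0, hb, hb']
      congr 1
      field_simp
      ring
    have f1 : (N : ℝ) ^ (-β) ≤ (N : ℝ) ^ (-b') := by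
      refine Real.rpow_le_rpow_of_exponent_le (by exact_mod_cast hN) ?_
      have : 0 ≤ (β - 1) / m := by positivity
      linarith
    rw [f2] at e2
    rw [← h.diagonal.head_add_tail N]
    have g1 : 0 ≤ (N : ℝ) ^ (2 : ℝ) * A := by positivity
    have g2 : 0 ≤ (N : ℝ) ^ (-b') := by positivity
    have g3 := mul_le_mul_of_nonneg_left f1 hK₁.le
    have g4 : K₁ * ((N : ℝ) ^ (2 : ℝ) * (κ * A) + (N : ℝ) ^ (-β)) =
      K₁ * κ * ((N : ℝ) ^ (2 : ℝ) * A) + K₁ * (N : ℝ) ^ (-β) := by ring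
    rw [g4] at e1
    have g5 := mul_nonneg (mul_nonneg hK₁.le hκ.le) g2
    have g6 := mul_nonneg hK₁.le g1
    have g7 := mul_nonneg hK₂.le g1
    calc _ ≤ _ := add_le_add e1 e2
      _ ≤ _ := by linarith
  obtain ⟨c', hc', hmain⟩ := hmain
  have hexp : 1 + 2 / b' ≤ β / (β - 1) := by
    have h1 : 2 / b' ≤ 1 / (β - 1) := by
      rw [div_le_div_iff₀ hb'0 hβ1]
      linarith
    have h2 : β / (β - 1) = 1 + 1 / (β - 1) := by field_simp; ring
    linarith
  set δ := β / (β - 1) - (1 + 2 / b') with hδ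
  refine ⟨min (c' / R ^ δ) (1 / R ^ (β / (β - 1))), by positivity, fun r A hS hr hrR => ?_⟩
  rcases le_or_gt A 1 with hA | hA
  · refine le_trans ?_ (hmain r A ⟨hA, hS⟩ hr hrR)
    have h3 : r ^ (β / (β - 1)) = r ^ δ * r ^ (1 + 2 / b') := by
      rw [← Real.rpow_add hr, hδ]
      congr 1
      ring
    have h4 : r ^ δ ≤ R ^ δ := Real.rpow_le_rpow hr.le hrR (by linarith)
    calc _ ≤ c' / R ^ δ * (R ^ δ * r ^ (1 + 2 / b')) := by
          rw [h3]
          refine mul_le_mul (min_le_left _ _) (by gcongr) (by positivity) (by positivity)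
      _ = _ := by
          have : R ^ δ ≠ 0 := by positivity
          field_simp
  · refine le_trans ?_ hA.le
    calc _ ≤ 1 / R ^ (β / (β - 1)) * R ^ (β / (β - 1)) :=
          mul_le_mul (min_le_right _ _) (Real.rpow_le_rpow hr.le hrR (by positivity))
            (by positivity) (by positivity)
      _ = 1 := by
          have : R ^ (β / (β - 1)) ≠ 0 := by positivity
          field_simp

/-! ### The representation of `Ψ_{2,Υ}` as a double sum -/

theorem HasSum.nat_succ_add_neg_succ {f : ℤ → ℝ} {a : ℝ} (hf : HasSum f a) (h0 : f 0 = 0) :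
    HasSum (fun n : ℕ => f (n + 1) + f (-(n + 1))) a := by
  have h := (hasSum_nat_add_iff' 1).2 hf.nat_add_neg
  simpa [h0] using h

theorem exists_bound_of_continuous {Φ : ℝ × ℝ × ℝ → ℝ} (hΦ : Continuous Φ) (K : ℝ) :
    ∃ M, ∀ a b c : ℝ, |a| ≤ K → |b| ≤ K → |c| ≤ K → |Φ (a, b, c)| ≤ M := by
  obtain ⟨M, hM⟩ := (isCompact_Icc (a := ((-K, -K, -K) : ℝ × ℝ × ℝ))
    (b := (K, K, K))).exists_bound_of_continuousOn hΦ.continuousOn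
  refine ⟨M, fun a b c ha hb hc => ?_⟩
  rw [abs_le] at ha hb hc
  exact hM (a, b, c) ⟨⟨ha.1, hb.1, hc.1⟩, ⟨ha.2, hb.2, hc.2⟩⟩

namespace IsKernel

variable {k : ℤ → ℝ}

/-- Convolution form of the sums over the kernel. -/
theorem tsum_sub_eq (hk : IsKernel k) (x : ℤ) (f : ℤ → ℝ) :
    ∑' y : ℤ, k (x - y) * f y = ∑' h : ℤ, k h * f (x + h) := by
  rw [← (Equiv.addLeft x).tsum_eq]
  refine tsum_congr fun h => ?_
  rw [Equiv.coe_addLeft, show x - (x + h) = -h by ring, hk.symm]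

theorem summable_mul_of_bounded (hk : IsKernel k) {f : ℤ → ℝ} {M : ℝ} (hf : ∀ h, |f h| ≤ M) :
    Summable (fun h => k h * f h) := by
  refine Summable.of_norm_bounded (hk.summable.mul_right M) fun h => ?_
  rw [norm_mul, Real.norm_of_nonneg (hk.nonneg h)]
  exact mul_le_mul_of_nonneg_left (hf h) (hk.nonneg h)

theorem summable_prod_mul_of_bounded (hk : IsKernel k) {G : ℤ × ℤ → ℝ} {M : ℝ}
    (hG : ∀ p, |G p| ≤ M) : Summable (fun p : ℤ × ℤ => k p.1 * k p.2 * G p) := by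
  have h := (hk.summable.mul_of_nonneg hk.summable hk.nonneg hk.nonneg)
  refine Summable.of_norm_bounded (h.mul_right M) fun p => ?_
  have h2 : 0 ≤ k p.1 * k p.2 := mul_nonneg (hk.nonneg _) (hk.nonneg _)
  rw [norm_mul, Real.norm_of_nonneg h2]
  exact mul_le_mul_of_nonneg_left (hG p) h2

theorem tsum_prod_mul_of_bounded (hk : IsKernel k) {G : ℤ × ℤ → ℝ} {M : ℝ}
    (hG : ∀ p, |G p| ≤ M) :
    ∑' p : ℤ × ℤ, k p.1 * k p.2 * G p = ∑' h, k h * ∑' j, k j * G (h, j) := by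
  rw [(hk.summable_prod_mul_of_bounded hG).tsum_prod]
  refine tsum_congr fun h => ?_
  rw [← tsum_mul_left]
  exact tsum_congr fun j => mul_assoc _ _ _

end IsKernel

/-- The summand `k(h) k(j) e^{v(j)} Υ(v(h + j) - v(h) - v(j))` in the representation of
`2 Ψ_{2,Υ}(u)(x)` as a double sum, where `v(h) = u(x + h) - u(x)`. -/
noncomputable def psi2Term (k v : ℤ → ℝ) (p : ℤ × ℤ) : ℝ :=
  k p.1 * k p.2 * (Real.exp (v p.2) * Upsilon (v (p.1 + p.2) - v p.1 - v p.2))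

theorem psi2Term_nonneg {k v : ℤ → ℝ} (hk : IsKernel k) (p : ℤ × ℤ) : 0 ≤ psi2Term k v p :=
  mul_nonneg (mul_nonneg (hk.nonneg _) (hk.nonneg _))
    (mul_nonneg (Real.exp_pos _).le (Upsilon_nonneg _))

theorem continuous_Upsilon : Continuous Upsilon := by unfold Upsilon; fun_prop

theorem continuous_UpsilonDeriv : Continuous UpsilonDeriv := by unfold UpsilonDeriv; fun_prop

theorem summable_psi2Term {k v : ℤ → ℝ} (hk : IsKernel k) {K : ℝ} (hv : ∀ h, |v h| ≤ K) :
    Summable (psi2Term k v) := by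
  have hΦ : Continuous (fun q : ℝ × ℝ × ℝ => Real.exp q.2.1 * Upsilon (q.2.2 - q.1 - q.2.1)) := by
    have := continuous_Upsilon
    fun_prop
  obtain ⟨M, hM⟩ := exists_bound_of_continuous hΦ K
  exact hk.summable_prod_mul_of_bounded (M := M)
    (G := fun p => Real.exp (v p.2) * Upsilon (v (p.1 + p.2) - v p.1 - v p.2))
    fun p => hM _ _ _ (hv _) (hv _) (hv _)

theorem kernelOp_eq {k : ℤ → ℝ} (hk : IsKernel k) (u : ℤ → ℝ) (x : ℤ) :
    kernelOp k u x = ∑' h : ℤ, k h * (u (x + h) - u x) :=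
  hk.tsum_sub_eq x (fun y => u y - u x)

theorem PsiUpsilon_eq {k : ℤ → ℝ} (hk : IsKernel k) (u : ℤ → ℝ) (x : ℤ) :
    PsiUpsilon k u x = ∑' h : ℤ, k h * Upsilon (u (x + h) - u x) :=
  hk.tsum_sub_eq x (fun y => Upsilon (u y - u x))

/-- The representation of `2 Ψ_{2,Υ}(u)(x)` as a double sum of nonnegative terms. With
`a = v(h)`, `b = v(j)`, `w = v(h + j) - a - b`, the definition of `Ψ_{2,Υ}` gives the summand
`e^b Υ(w) + (e^b - e^a) w`, whose second part is antisymmetric in `(h, j)`. -/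
theorem two_mul_Psi2Upsilon_eq {k u : ℤ → ℝ} (hk : IsKernel k) (hu : IsBoundedFun u) (x : ℤ) :
    2 * Psi2Upsilon k u x = ∑' p, psi2Term k (fun h => u (x + h) - u x) p := by
  obtain ⟨C, hC⟩ := hu
  set v : ℤ → ℝ := fun h => u (x + h) - u x with hv
  have hdiff : ∀ y z, |u y - u z| ≤ 2 * C := fun y z => by
    have h1 := abs_le.1 (hC y)
    have h2 := abs_le.1 (hC z)
    rw [abs_le]
    constructor <;> linarith
  have hvb : ∀ h, |v h| ≤ 2 * C := fun h => hdiff _ _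
  have hbd : ∀ Φ : ℝ × ℝ × ℝ → ℝ, Continuous Φ →
      ∃ M, ∀ p : ℤ × ℤ, |Φ (v p.1, v p.2, v (p.1 + p.2))| ≤ M := fun Φ hΦ => by
    obtain ⟨M, hM⟩ := exists_bound_of_continuous hΦ (2 * C)
    exact ⟨M, fun p => hM _ _ _ (hvb _) (hvb _) (hvb _)⟩
  have hU := continuous_Upsilon
  have hU' := continuous_UpsilonDeriv
  -- the two parts of `2 Ψ_{2,Υ}` as double sums
  let Φ₁ : ℝ × ℝ × ℝ → ℝ := fun q => Upsilon (q.2.2 - q.1) - Upsilon q.2.1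
  let Φ₂ : ℝ × ℝ × ℝ → ℝ := fun q => UpsilonDeriv q.1 * (q.2.2 - q.1 - q.2.1)
  let Φ₃ : ℝ × ℝ × ℝ → ℝ := fun q => (Real.exp q.2.1 - Real.exp q.1) * (q.2.2 - q.1 - q.2.1)
  obtain ⟨M₁, hM₁⟩ := hbd Φ₁ (by fun_prop)
  obtain ⟨M₂, hM₂⟩ := hbd Φ₂ (by fun_prop)
  obtain ⟨M₃, hM₃⟩ := hbd Φ₃ (by fun_prop)
  obtain ⟨MU, hMU⟩ := exists_bound_of_continuous (Φ := fun q => Upsilon q.1) (by fun_prop) (2 * C)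
  have hMU' : ∀ y z, |Upsilon (u y - u z)| ≤ MU := fun y z =>
    hMU _ _ _ (hdiff y z) (hdiff y z) (hdiff y z)
  have hdd : ∀ h j : ℤ, u (x + h + j) - u (x + h) = v (h + j) - v h := fun h j => by
    simp only [hv, ← add_assoc]
    ring
  have e1 : kernelOp k (PsiUpsilon k u) x =
      ∑' p : ℤ × ℤ, k p.1 * k p.2 * Φ₁ (v p.1, v p.2, v (p.1 + p.2)) := by
    rw [hk.tsum_prod_mul_of_bounded hM₁, kernelOp_eq hk]
    refine tsum_congr fun h => ?_
    rw [PsiUpsilon_eq hk, PsiUpsilon_eq hk,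
      ← (hk.summable_mul_of_bounded (M := MU) fun j => hMU' _ _).tsum_sub
        (hk.summable_mul_of_bounded (M := MU) fun j => hMU' _ _)]
    congr 1
    refine tsum_congr fun j => ?_
    rw [hdd]
    simp only [Φ₁, hv]
    ring
  have e2 : BUpsilonDeriv k u (kernelOp k u) x =
      ∑' p : ℤ × ℤ, k p.1 * k p.2 * Φ₂ (v p.1, v p.2, v (p.1 + p.2)) := by
    rw [hk.tsum_prod_mul_of_bounded hM₂]
    have h1 := hk.tsum_sub_eq x
      (fun y => UpsilonDeriv (u y - u x) * (kernelOp k u y - kernelOp k u x))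
    simp only [← mul_assoc] at h1
    refine h1.trans (tsum_congr fun h => ?_)
    rw [kernelOp_eq hk, kernelOp_eq hk, mul_assoc,
      ← (hk.summable_mul_of_bounded (M := 2 * C) fun j => hdiff _ _).tsum_sub
        (hk.summable_mul_of_bounded (M := 2 * C) fun j => hdiff _ _), ← tsum_mul_left]
    congr 1
    refine tsum_congr fun j => ?_
    rw [hdd]
    simp only [Φ₂, hv]
    ring
  have e3 : ∑' p : ℤ × ℤ, k p.1 * k p.2 * Φ₃ (v p.1, v p.2, v (p.1 + p.2)) = 0 := by
    have h1 := (Equiv.prodComm ℤ ℤ).tsum_eq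
      (fun p : ℤ × ℤ => k p.1 * k p.2 * Φ₃ (v p.1, v p.2, v (p.1 + p.2)))
    have h2 : ∀ p : ℤ × ℤ, (fun p : ℤ × ℤ => k p.1 * k p.2 * Φ₃ (v p.1, v p.2, v (p.1 + p.2)))
        (Equiv.prodComm ℤ ℤ p) = -(k p.1 * k p.2 * Φ₃ (v p.1, v p.2, v (p.1 + p.2))) := by
      intro p
      simp only [Equiv.prodComm_apply, Prod.fst_swap, Prod.snd_swap, Φ₃, add_comm p.2 p.1]
      ring
    rw [tsum_congr h2, tsum_neg] at h1
    linarith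
  have hs := summable_psi2Term hk hvb
  have hs3 := hk.summable_prod_mul_of_bounded hM₃
  have e4 : ∑' p, psi2Term k v p = ∑' p, psi2Term k v p +
      ∑' p : ℤ × ℤ, k p.1 * k p.2 * Φ₃ (v p.1, v p.2, v (p.1 + p.2)) := by rw [e3, add_zero]
  unfold Psi2Upsilon
  rw [e4, ← hs.tsum_add hs3, e1, e2, ← (hk.summable_prod_mul_of_bounded hM₁).tsum_sub
    (hk.summable_prod_mul_of_bounded hM₂), ← mul_assoc, mul_one_div_cancel two_ne_zero, one_mul]
  refine tsum_congr fun p => ?_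
  have hexp : Real.exp (v (p.1 + p.2) - v p.1) =
      Real.exp (v p.2) * Real.exp (v (p.1 + p.2) - v p.1 - v p.2) := by
    rw [← Real.exp_add]
    congr 1
    ring
  simp only [psi2Term, Φ₁, Φ₂, Φ₃, Upsilon, UpsilonDeriv]
  rw [hexp]
  ring

/-- The double sum is invariant under reflection of `v`. -/
theorem tsum_psi2Term_neg {k : ℤ → ℝ} (hk : IsKernel k) (v : ℤ → ℝ) :
    ∑' p, psi2Term k (fun h => v (-h)) p = ∑' p, psi2Term k v p := by
  rw [← ((Equiv.neg ℤ).prodCongr (Equiv.neg ℤ)).tsum_eq (psi2Term k v)]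
  refine tsum_congr fun p => ?_
  simp only [psi2Term, Equiv.prodCongr_apply, Prod.map_fst, Prod.map_snd, Equiv.neg_apply,
    hk.symm, neg_add]

/-- The diagonal terms `j = -h` of the double sum. -/
theorem diagonalBound_of_kernel {k v : ℤ → ℝ} (hk : IsKernel k) {K : ℝ} (hv : ∀ h, |v h| ≤ K)
    (hv0 : v 0 = 0) :
    DiagonalBound (fun n : ℕ => k (n + 1)) (fun n => -v (n + 1) - v (-(n + 1)))
      (-∑' h, k h * v h) (∑' p, psi2Term k v p) := by
  have hs := summable_psi2Term hk hv
  have hinj : Function.Injective (fun j : ℤ => ((-j, j) : ℤ × ℤ)) := fun i j h =>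
    (Prod.ext_iff.1 h).2
  have hle := tsum_comp_le_tsum_of_inj hs (psi2Term_nonneg hk) hinj
  have hsd := hs.comp_injective hinj
  have hd := hsd.hasSum.nat_succ_add_neg_succ (by simp [psi2Term, hk.zero])
  have hterm : ∀ n : ℕ, k (n + 1) ^ 2 * (Real.exp (-(-v (n + 1) - v (-(n + 1))) / 2) *
      Upsilon (-v (n + 1) - v (-(n + 1)))) ≤
      psi2Term k v (-(n + 1), n + 1) + psi2Term k v (- -(n + 1), -(n + 1)) := by
    intro n
    simp only [psi2Term, neg_neg, add_neg_cancel, neg_add_cancel, hv0, hk.symm]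
    set a := v (n + 1)
    set b := v (-(n + 1))
    rw [show (0 : ℝ) - b - a = -a - b by ring, show (0 : ℝ) - a - b = -a - b by ring]
    have h1 : Real.exp (-(-a - b) / 2) ≤ Real.exp a + Real.exp b := by
      rcases le_total a b with h | h
      · have := Real.exp_le_exp.2 (by linarith : -(-a - b) / 2 ≤ b)
        linarith [Real.exp_pos a]
      · have := Real.exp_le_exp.2 (by linarith : -(-a - b) / 2 ≤ a)
        linarith [Real.exp_pos b]
    have h2 := mul_le_mul_of_nonneg_right h1 (Upsilon_nonneg (-a - b))
    have h3 := mul_le_mul_of_nonneg_left h2 (sq_nonneg (k (n + 1)))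
    linarith
  have hsum := Summable.of_nonneg_of_le
    (fun n => mul_nonneg (sq_nonneg _) (exp_mul_Upsilon_nonneg _)) hterm hd.summable
  refine ⟨?_, hsum, (hsum.tsum_le_tsum hterm hd.summable).trans (hd.tsum_eq.le.trans hle)⟩
  have h := (hk.summable_mul_of_bounded hv).hasSum.neg.nat_succ_add_neg_succ (by simp [hv0])
  convert h using 2 with n
  rw [hk.symm]
  ring

/-- The terms of the double sum with `j = 1`. -/
theorem unitStepBound_of_kernel {k v : ℤ → ℝ} (hk : IsKernel k) {K ω : ℝ} (hv : ∀ h, |v h| ≤ K)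
    (hv0 : v 0 = 0) (hk1 : 0 < k 1) (hω : 0 < ω)
    (h1 : ∑' p, psi2Term k v p ≤ 1 → ω ≤ Real.exp (v 1)) :
    UnitStepBound (fun n : ℕ => k (n + 1)) (1 / (k 1 * ω)) v
      (-∑' h, k h * v h) (∑' p, psi2Term k v p) := by
  refine ⟨hv0, diagonalBound_of_kernel hk hv hv0, fun hA N => ?_⟩
  have hω1 := h1 hA
  have hs := summable_psi2Term hk hv
  have hinj : Function.Injective (fun h : ℤ => ((h, 1) : ℤ × ℤ)) := fun i j h =>
    (Prod.ext_iff.1 h).1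
  have hle := tsum_comp_le_tsum_of_inj hs (psi2Term_nonneg hk) hinj
  have hd := (hs.comp_injective hinj).hasSum.nat_succ_add_neg_succ (by simp [psi2Term, hk.zero])
  have hterm : ∀ n : ℕ, (k 1 * ω) * (k (n + 1) *
      (Upsilon (unitDefect v (n + 1)) + Upsilon (unitDefect v (-(n + 1))))) ≤
      psi2Term k v (n + 1, 1) + psi2Term k v (-(n + 1), 1) := by
    intro n
    simp only [psi2Term, hk.symm]
    change _ ≤ k (n + 1) * k 1 * (Real.exp (v 1) * Upsilon (unitDefect v (n + 1))) +
      k (n + 1) * k 1 * (Real.exp (v 1) * Upsilon (unitDefect v (-(n + 1))))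
    have h2 : 0 ≤ k (n + 1) * k 1 *
        (Upsilon (unitDefect v (n + 1)) + Upsilon (unitDefect v (-(n + 1)))) :=
      mul_nonneg (mul_nonneg (hk.nonneg _) hk1.le)
        (add_nonneg (Upsilon_nonneg _) (Upsilon_nonneg _))
    have h3 := mul_le_mul_of_nonneg_right hω1 h2
    linarith
  have h4 := Finset.sum_le_sum fun n (_ : n ∈ Finset.range N) => hterm n
  rw [← Finset.mul_sum] at h4
  have h5 := (hd.summable.sum_le_tsum (Finset.range N) fun n _ =>
    add_nonneg (psi2Term_nonneg hk _) (psi2Term_nonneg hk _)).trans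
      (hd.tsum_eq.le.trans hle)
  rw [one_div_mul_eq_div, le_div_iff₀' (by positivity)]
  exact h4.trans h5

/-- For one of the two reflections of `v`, the terms with `j = 1` have a weight that is bounded
below, since the diagonal term with `h = 1` bounds `-v(1) - v(-1)`. -/
theorem exists_unitStepBound {k : ℤ → ℝ} (hk : IsKernel k) (hk1 : 0 < k 1) :
    ∃ κ : ℝ, 0 < κ ∧ ∀ (v : ℤ → ℝ) (K : ℝ), (∀ h, |v h| ≤ K) → v 0 = 0 →
      ∃ v', UnitStepBound (fun n : ℕ => k (n + 1)) κ v'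
        (-∑' h, k h * v h) (∑' p, psi2Term k v p) := by
  obtain ⟨C, -, hY⟩ := exists_le_mul_add_rpow (n := 1) le_rfl
  set W := (1 / k 1 ^ 2 + C) / 2 with hW
  refine ⟨1 / (k 1 * Real.exp (-W)), by positivity, fun v K hv hv0 => ?_⟩
  have hsum : ∑' p, psi2Term k v p ≤ 1 → -v 1 - v (-1) ≤ 2 * W := by
    intro hA
    have h1 := (diagonalBound_of_kernel hk hv hv0).single_le 0
    have h2 := hY 1 (-v 1 - v (-1)) one_pos
    simp only [Nat.cast_zero, zero_add] at h1
    rw [Real.one_rpow, one_mul, mul_one] at h2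
    have h3 : Real.exp (-(-v 1 - v (-1)) / 2) * Upsilon (-v 1 - v (-1)) ≤ 1 / k 1 ^ 2 := by
      rw [le_div_iff₀' (by positivity)]
      exact h1.trans hA
    rw [hW]
    linarith
  by_cases h : ∑' p, psi2Term k v p ≤ 1 → -W ≤ v 1
  · exact ⟨v, unitStepBound_of_kernel hk hv hv0 hk1 (Real.exp_pos _)
      fun hA => Real.exp_le_exp.2 (h hA)⟩
  · push Not at h
    obtain ⟨hA, hv1⟩ := h
    have h4 := hsum hA
    refine ⟨fun h => v (-h), ?_⟩
    have h5 : ∑' h, k h * v h = ∑' h, k h * v (-h) := by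
      rw [← (Equiv.neg ℤ).tsum_eq (fun h => k h * v h)]
      refine tsum_congr fun h => ?_
      rw [Equiv.neg_apply, hk.symm]
    rw [← tsum_psi2Term_neg hk, h5]
    exact unitStepBound_of_kernel hk (fun h => hv (-h)) (by simpa using hv0) hk1 (Real.exp_pos _)
      fun _ => Real.exp_le_exp.2 (by linarith)

/-! ### The kernel of the fractional Laplacian -/

/-- A first order recursion whose factor is `1 - (1 + 2 s) / n + O(n⁻²)` forces decay of the order
`n^{-1-2s}`; the two bounds are Bernoulli's inequality with the two natural choices of shift. -/
theorem isPowerLike_of_recursion {s : ℝ} (hs : 0 < s) (hs1 : s < 1) {a : ℕ → ℝ} (ha : 0 < a 0)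
    (hrec : ∀ n : ℕ, (n + 2 + s) * a (n + 1) = (n + 1 - s) * a n) :
    IsPowerLike (2 * s) (a 0 * (1 - s) ^ (1 + 2 * s)) (a 0 * (1 + s) ^ (1 + 2 * s)) a := by
  have h1s : 0 < 1 - s := by linarith
  have hstep : ∀ n : ℕ, a (n + 1) = (n + 1 - s) / (n + 2 + s) * a n := fun n => by
    have : (0 : ℝ) < n + 2 + s := by positivity
    field_simp
    linarith [hrec n]
  have hpos : ∀ n : ℕ, 0 < a n := by
    intro n
    induction n with
    | zero => exact ha
    | succ n ih =>
      rw [hstep]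
      have : (0 : ℝ) < n + 1 - s := by linarith [Nat.cast_nonneg (α := ℝ) n]
      positivity
  have hlow : ∀ n : ℕ, a 0 * (1 - s) ^ (1 + 2 * s) ≤ a n * ((n : ℝ) + 1 - s) ^ (1 + 2 * s) := by
    intro n
    induction n with
    | zero => simp
    | succ n ih =>
      refine ih.trans ?_
      have hn : (0 : ℝ) < n + 1 - s := by linarith [Nat.cast_nonneg (α := ℝ) n]
      have h := one_add_mul_self_le_rpow_one_add (s := 1 / ((n : ℝ) + 1 - s))
        (by have : 0 ≤ 1 / ((n : ℝ) + 1 - s) := by positivity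
            linarith) (p := 1 + 2 * s) (by linarith)
      have e1 : 1 + 1 / ((n : ℝ) + 1 - s) = (n + 2 - s) / (n + 1 - s) := by field_simp; ring
      have e2 : 1 + (1 + 2 * s) * (1 / ((n : ℝ) + 1 - s)) = (n + 2 + s) / (n + 1 - s) := by
        field_simp; ring
      have hn2 : (0 : ℝ) < n + 2 - s := by linarith
      rw [e1, e2, Real.div_rpow hn2.le hn.le, div_le_div_iff₀ hn (by positivity)] at h
      rw [hstep]
      push_cast
      rw [show (n : ℝ) + 1 + 1 - s = n + 2 - s by ring]
      have h2 : (0 : ℝ) < n + 2 + s := by positivity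
      rw [div_mul_eq_mul_div, div_mul_eq_mul_div, le_div_iff₀ h2]
      nlinarith [mul_le_mul_of_nonneg_left h (hpos n).le]
  have hupp : ∀ n : ℕ, a n * ((n : ℝ) + 1 + s) ^ (1 + 2 * s) ≤ a 0 * (1 + s) ^ (1 + 2 * s) := by
    intro n
    induction n with
    | zero => simp
    | succ n ih =>
      refine le_trans ?_ ih
      have hn : (0 : ℝ) < n + 2 + s := by positivity
      have hle : 1 / ((n : ℝ) + 2 + s) ≤ 1 := by
        rw [div_le_one hn]
        linarith [Nat.cast_nonneg (α := ℝ) n]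
      have h := one_add_mul_self_le_rpow_one_add (s := -(1 / ((n : ℝ) + 2 + s)))
        (by linarith) (p := 1 + 2 * s) (by linarith)
      have e1 : 1 + -(1 / ((n : ℝ) + 2 + s)) = (n + 1 + s) / (n + 2 + s) := by field_simp; ring
      have e2 : 1 + (1 + 2 * s) * -(1 / ((n : ℝ) + 2 + s)) = (n + 1 - s) / (n + 2 + s) := by
        field_simp; ring
      rw [e1, e2, Real.div_rpow (by positivity) hn.le, div_le_div_iff₀ hn (by positivity)] at h
      rw [hstep]
      push_cast
      rw [show (n : ℝ) + 1 + 1 + s = n + 2 + s by ring]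
      rw [div_mul_eq_mul_div, div_mul_eq_mul_div, div_le_iff₀ hn]
      nlinarith [mul_le_mul_of_nonneg_left h (hpos n).le]
  refine ⟨by positivity, fun n => ?_, fun n => ?_⟩
  · have hn : (0 : ℝ) < n + 1 - s := by linarith [Nat.cast_nonneg (α := ℝ) n]
    have hn1 : (0 : ℝ) < ((n + 1 : ℕ) : ℝ) := by positivity
    have h2 : ((n : ℝ) + 1 - s) ^ (1 + 2 * s) ≤ ((n + 1 : ℕ) : ℝ) ^ (1 + 2 * s) :=
      Real.rpow_le_rpow hn.le (by push_cast; linarith) (by linarith)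
    rw [show -1 - 2 * s = -(1 + 2 * s) by ring, Real.rpow_neg hn1.le, ← div_eq_mul_inv,
      div_le_iff₀ (by positivity)]
    exact (hlow n).trans (mul_le_mul_of_nonneg_left h2 (hpos n).le)
  · have hn1 : (0 : ℝ) < ((n + 1 : ℕ) : ℝ) := by positivity
    have h2 : ((n + 1 : ℕ) : ℝ) ^ (1 + 2 * s) ≤ ((n : ℝ) + 1 + s) ^ (1 + 2 * s) :=
      Real.rpow_le_rpow hn1.le (by push_cast; linarith) (by linarith)
    rw [show -1 - 2 * s = -(1 + 2 * s) by ring, Real.rpow_neg hn1.le, ← div_eq_mul_inv,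
      le_div_iff₀ (by positivity)]
    exact (mul_le_mul_of_nonneg_left h2 (hpos n).le).trans (hupp n)

/-- The weight `∫_0^∞ e^{-2t} t^{n+m-1-s} dt / (n! m!) = Γ(n+m-s) 2^{-(n+m-s)} / (n! m!)` of the pair
of `n` jumps to the right and `m` jumps to the left, set to `0` for `n = m`, where the total
displacement vanishes. -/
noncomputable def jumpWeight (s : ℝ) (p : ℕ × ℕ) : ℝ :=
  if p.1 = p.2 then 0
  else (1 / 2) ^ ((p.1 : ℝ) + p.2 - s) * Real.Gamma (p.1 + p.2 - s) /
    (p.1.factorial * p.2.factorial)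

theorem add_sub_pos_of_ne {s : ℝ} (hs1 : s < 1) {n m : ℕ} (h : n ≠ m) :
    (0 : ℝ) < (n : ℝ) + m - s := by
  have : (1 : ℝ) ≤ (n : ℝ) + m := by exact_mod_cast (by omega : 1 ≤ n + m)
  linarith

theorem jumpWeight_pos {s : ℝ} (hs1 : s < 1) {p : ℕ × ℕ} (h : p.1 ≠ p.2) :
    0 < jumpWeight s p := by
  have := Real.Gamma_pos_of_pos (add_sub_pos_of_ne hs1 h)
  rw [jumpWeight, if_neg h]
  positivity

theorem jumpWeight_nonneg {s : ℝ} (hs1 : s < 1) (p : ℕ × ℕ) : 0 ≤ jumpWeight s p := by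
  by_cases h : p.1 = p.2
  · rw [jumpWeight, if_pos h]
  · exact (jumpWeight_pos hs1 h).le

theorem jumpWeight_swap (s : ℝ) (n m : ℕ) : jumpWeight s (n, m) = jumpWeight s (m, n) := by
  simp only [jumpWeight, eq_comm (a := n), add_comm (n : ℝ), mul_comm (n.factorial : ℝ)]

/-- `∑ Γ(N - s) / N!` converges since `Γ(N - s) / N! = (b_N - b_{N+1}) / s` for
`b_N = Γ(N - s) / (N - 1)!`. -/
theorem summable_Gamma_div_factorial {s : ℝ} (hs : 0 < s) (hs1 : s < 1) :
    Summable (fun N : ℕ => Real.Gamma (N + 1 - s) / (N + 1).factorial) := by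
  have hpos : ∀ N : ℕ, (0 : ℝ) < N + 1 - s := fun N => by linarith [Nat.cast_nonneg (α := ℝ) N]
  have hG : ∀ N : ℕ, 0 < Real.Gamma (N + 1 - s) := fun N => Real.Gamma_pos_of_pos (hpos N)
  have htel : ∀ N : ℕ, Real.Gamma (N + 1 - s) / (N + 1).factorial =
      Real.Gamma (N + 1 - s) / N.factorial / s -
        Real.Gamma ((N + 1 : ℕ) + 1 - s) / (N + 1).factorial / s := by
    intro N
    have h1 : Real.Gamma ((N + 1 : ℕ) + 1 - s) = (N + 1 - s) * Real.Gamma (N + 1 - s) := by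
      rw [← Real.Gamma_add_one (hpos N).ne']
      congr 1
      push_cast
      ring
    rw [h1, Nat.factorial_succ]
    have h2 : (N.factorial : ℝ) ≠ 0 := by positivity
    push_cast
    field_simp
    ring
  refine summable_of_sum_range_le (c := Real.Gamma ((0 : ℕ) + 1 - s) / (0 : ℕ).factorial / s)
    (fun N => by have := hG N; positivity) fun M => ?_
  rw [Finset.sum_congr rfl fun N _ => htel N,
    Finset.sum_range_sub' (fun N : ℕ => Real.Gamma (N + 1 - s) / N.factorial / s)]
  have : 0 ≤ Real.Gamma (M + 1 - s) / M.factorial / s := by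
    have := hG M
    positivity
  linarith

theorem sum_antidiagonal_inv_factorial (N : ℕ) :
    ∑ p ∈ Finset.HasAntidiagonal.antidiagonal N, (1 : ℝ) / (p.1.factorial * p.2.factorial) =
      2 ^ N / N.factorial := by
  have h := (Commute.all (1 : ℝ) 1).add_pow' N
  rw [one_add_one_eq_two] at h
  rw [h, Finset.sum_div]
  refine Finset.sum_congr rfl fun p hp => ?_
  obtain rfl := Finset.HasAntidiagonal.mem_antidiagonal.1 hp
  have h2 := Nat.add_choose_mul_factorial_mul_factorial p.1 p.2
  rw [← Nat.choose_symm_add] at h2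
  have h3 : (((p.1 + p.2).choose p.1 : ℕ) : ℝ) * p.1.factorial * p.2.factorial =
      (p.1 + p.2).factorial := by exact_mod_cast h2
  rw [one_pow, one_pow, mul_one, nsmul_one, ← h3]
  have h4 : (((p.1 + p.2).choose p.1 : ℕ) : ℝ) ≠ 0 := by
    exact_mod_cast (Nat.choose_pos (Nat.le_add_right _ _)).ne'
  field_simp

theorem summable_jumpWeight {s : ℝ} (hs : 0 < s) (hs1 : s < 1) : Summable (jumpWeight s) := by
  rw [← Finset.HasAntidiagonal.sigmaAntidiagonalEquivProd.summable_iff]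
  refine (summable_sigma_of_nonneg fun _ => jumpWeight_nonneg hs1 _).2
    ⟨fun N => Summable.of_finite, ?_⟩
  rw [← summable_nat_add_iff 1]
  refine Summable.of_nonneg_of_le
    (fun N => tsum_nonneg fun _ => jumpWeight_nonneg hs1 _) (fun N => ?_)
    ((summable_Gamma_div_factorial hs hs1).mul_left (2 ^ s))
  have hpos : (0 : ℝ) < N + 1 - s := by linarith [Nat.cast_nonneg (α := ℝ) N]
  have hG := Real.Gamma_pos_of_pos hpos
  rw [tsum_fintype]
  change ∑ p : Finset.HasAntidiagonal.antidiagonal (N + 1), jumpWeight s p.1 ≤ _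
  rw [Finset.sum_coe_sort (Finset.HasAntidiagonal.antidiagonal (N + 1)) (jumpWeight s)]
  have hterm : ∀ p ∈ Finset.HasAntidiagonal.antidiagonal (N + 1), jumpWeight s p ≤
      (1 / 2) ^ ((N : ℝ) + 1 - s) * Real.Gamma (N + 1 - s) *
        (1 / (p.1.factorial * p.2.factorial)) := by
    intro p hp
    have hp' : (p.1 : ℝ) + p.2 = N + 1 := by
      exact_mod_cast Finset.HasAntidiagonal.mem_antidiagonal.1 hp
    rw [jumpWeight, hp']
    split_ifs
    · positivity
    · rw [mul_one_div]
  refine (Finset.sum_le_sum hterm).trans (le_of_eq ?_)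
  rw [← Finset.mul_sum, sum_antidiagonal_inv_factorial, Real.rpow_sub (by norm_num),
    ← Nat.cast_succ, Real.rpow_natCast, one_div, Real.inv_rpow (by norm_num), inv_pow]
  field_simp

/-- The pairs of numbers of jumps, parametrised by the displacement `j` and the number of
cancelling pairs of jumps. -/
def displacementEquiv : ℤ × ℕ ≃ ℕ × ℕ where
  toFun q := (q.2 + q.1.toNat, q.2 + (-q.1).toNat)
  invFun p := ((p.1 : ℤ) - p.2, min p.1 p.2)
  left_inv q := by
    ext
    · simp only; omega
    · simp only; omega
  right_inv p := by
    ext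
    · simp only; omega
    · simp only; omega

/-- The kernel of `-(-Δ)^s`. -/
noncomputable def fracKernel (s : ℝ) (j : ℤ) : ℝ :=
  -(Real.Gamma (-s))⁻¹ * ∑' m : ℕ, jumpWeight s (displacementEquiv (j, m))

theorem neg_inv_Gamma_neg_pos {s : ℝ} (hs : 0 < s) (hs1 : s < 1) :
    0 < -(Real.Gamma (-s))⁻¹ := by
  have h := Real.Gamma_add_one (neg_ne_zero.2 hs.ne')
  have h2 : 0 < Real.Gamma (-s + 1) := Real.Gamma_pos_of_pos (by linarith)
  have h3 : Real.Gamma (-s) < 0 := by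
    by_contra hcon
    nlinarith
  have := inv_lt_zero.2 h3
  linarith

theorem summable_jumpWeight_fiber {s : ℝ} (hs : 0 < s) (hs1 : s < 1) (j : ℤ) :
    Summable (fun m : ℕ => jumpWeight s (displacementEquiv (j, m))) :=
  (displacementEquiv.summable_iff.2 (summable_jumpWeight hs hs1)).prod_factor j

theorem fracKernel_pos {s : ℝ} (hs : 0 < s) (hs1 : s < 1) {j : ℤ} (hj : j ≠ 0) :
    0 < fracKernel s j :=
  mul_pos (neg_inv_Gamma_neg_pos hs hs1) <|
    (summable_jumpWeight_fiber hs hs1 j).tsum_pos (fun _ => jumpWeight_nonneg hs1 _) 0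
      (jumpWeight_pos hs1 (by simp only [displacementEquiv, Equiv.coe_fn_mk]; omega))

theorem isKernel_fracKernel {s : ℝ} (hs : 0 < s) (hs1 : s < 1) : IsKernel (fracKernel s) where
  nonneg j := mul_nonneg (neg_inv_Gamma_neg_pos hs hs1).le
    (tsum_nonneg fun _ => jumpWeight_nonneg hs1 _)
  zero := by
    unfold fracKernel
    simp [displacementEquiv, jumpWeight]
  symm j := by
    unfold fracKernel
    congr 1
    refine tsum_congr fun m => ?_
    simp only [displacementEquiv, Equiv.coe_fn_mk, neg_neg]
    exact jumpWeight_swap _ _ _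
  summable := (displacementEquiv.summable_iff.2 (summable_jumpWeight hs hs1)).prod.mul_left _
  nontrivial := ⟨1, (fracKernel_pos hs hs1 one_ne_zero).ne'⟩

/-- The recursion `(j + 1 + s) k(j + 1) = (j - s) k(j)` for the kernel, at `j = n + 1`. The
difference of the two sides of the corresponding identity for the weights is the telescoping
difference of `2 m X_m`, where `X_m` is the weight of `m + j` jumps to the right and `m` jumps to
the left. -/
theorem fracKernel_recursion {s : ℝ} (hs : 0 < s) (hs1 : s < 1) (n : ℕ) :
    (n + 2 + s) * fracKernel s ((n + 1 : ℕ) + 1) = (n + 1 - s) * fracKernel s (n + 1) := by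
  set X : ℕ → ℝ := fun m => jumpWeight s (m + (n + 1), m) with hX
  set Y : ℕ → ℝ := fun m => jumpWeight s (m + (n + 2), m) with hY
  have eX : ∀ m, jumpWeight s (displacementEquiv ((n : ℤ) + 1, m)) = X m := fun m => by
    simp only [displacementEquiv, Equiv.coe_fn_mk, hX]
    congr 2
  have eY : ∀ m, jumpWeight s (displacementEquiv (((n + 1 : ℕ) : ℤ) + 1, m)) = Y m := fun m => by
    simp only [displacementEquiv, Equiv.coe_fn_mk, hY]
    congr 2
  have hXs : Summable X := by
    simpa only [eX] using summable_jumpWeight_fiber hs hs1 ((n : ℤ) + 1)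
  have hYs : Summable Y := by
    simpa only [eY] using summable_jumpWeight_fiber hs hs1 (((n + 1 : ℕ) : ℤ) + 1)
  have hcert : ∀ m : ℕ, (n + 2 + s) * Y m - (n + 1 - s) * X m =
      2 * m * X m - 2 * (m + 1 : ℕ) * X (m + 1) := by
    intro m
    set z : ℝ := 2 * m + n + 1 - s with hz
    have hz0 : 0 < z := by
      have h1 := Nat.cast_nonneg (α := ℝ) n
      have h2 := Nat.cast_nonneg (α := ℝ) m
      linarith
    have hG1 : Real.Gamma (z + 1) = z * Real.Gamma z := Real.Gamma_add_one hz0.ne'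
    have hG2 : Real.Gamma (z + 2) = (z + 1) * (z * Real.Gamma z) := by
      rw [← hG1, ← Real.Gamma_add_one (by positivity)]
      congr 1
      ring
    have f1 : ((m + (n + 1)).factorial : ℝ) ≠ 0 := by positivity
    have f2 : (m.factorial : ℝ) ≠ 0 := by positivity
    have x1 : X m = (1 / 2) ^ z * Real.Gamma z / ((m + (n + 1)).factorial * m.factorial) := by
      simp only [hX, jumpWeight]
      rw [if_neg (by omega)]
      rw [show ((m + (n + 1) : ℕ) : ℝ) + (m : ℕ) - s = z by rw [hz]; push_cast; ring]
    have y1 : Y m = (1 / 2) ^ z * (1 / 2) * (z * Real.Gamma z) /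
        (((m + n + 2 : ℕ) : ℝ) * (m + (n + 1)).factorial * m.factorial) := by
      simp only [hY, jumpWeight]
      rw [if_neg (by omega)]
      rw [show ((m + (n + 2) : ℕ) : ℝ) + (m : ℕ) - s = z + 1 by rw [hz]; push_cast; ring, hG1,
        Real.rpow_add_one (by norm_num), show m + (n + 2) = (m + (n + 1)) + 1 by ring,
        Nat.factorial_succ]
      push_cast
      ring
    have x2 : X (m + 1) = (1 / 2) ^ z * (1 / 4) * ((z + 1) * (z * Real.Gamma z)) /
        (((m + n + 2 : ℕ) : ℝ) * (m + (n + 1)).factorial * ((m + 1 : ℕ) * m.factorial)) := by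
      simp only [hX, jumpWeight]
      rw [if_neg (by omega)]
      rw [show ((m + 1 + (n + 1) : ℕ) : ℝ) + ((m + 1 : ℕ) : ℝ) - s = z + 2 by
          rw [hz]; push_cast; ring, hG2, Real.rpow_add (by norm_num), Real.rpow_two,
        show m + 1 + (n + 1) = (m + (n + 1)) + 1 by ring,
        Nat.factorial_succ, Nat.factorial_succ m]
      push_cast
      ring
    rw [x1, y1, x2]
    have hs' : s = 2 * m + n + 1 - z := by rw [hz]; ring
    rw [hs']
    push_cast
    field_simp
    ring
  -- the telescoping sum has a limit, which vanishes because `X` is summable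
  have hlim : ∃ L, Tendsto (fun m : ℕ => 2 * (m : ℝ) * X m) atTop (𝓝 L) ∧
      ∑' m, ((n + 2 + s) * Y m - (n + 1 - s) * X m) = -L := by
    have hsum := ((hYs.mul_left (n + 2 + s)).sub (hXs.mul_left (n + 1 - s))).hasSum
    have h1 := hsum.tendsto_sum_nat
    have h2 : ∀ M, ∑ m ∈ Finset.range M, ((n + 2 + s) * Y m - (n + 1 - s) * X m) =
        -(2 * (M : ℝ) * X M) := by
      intro M
      rw [Finset.sum_congr rfl fun m _ => hcert m,
        Finset.sum_range_sub' (fun m : ℕ => 2 * (m : ℝ) * X m)]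
      simp
    simp only [h2] at h1
    refine ⟨_, by simpa using h1.neg, by simp⟩
  obtain ⟨L, hL, htsum⟩ := hlim
  have hX0 : ∀ m, 0 ≤ X m := fun m => jumpWeight_nonneg hs1 _
  have hL0 : L = 0 := by
    by_contra hne
    have hLpos : 0 < L := lt_of_le_of_ne
      (ge_of_tendsto' hL fun m => mul_nonneg (by positivity) (hX0 m)) (Ne.symm hne)
    have hev : ∀ᶠ m : ℕ in atTop, L / 2 < 2 * (m : ℝ) * X m :=
      hL.eventually (lt_mem_nhds (by linarith))
    have hdiv : Summable (fun m : ℕ => (1 : ℝ) / m) := by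
      refine Summable.of_norm_bounded_eventually_nat (hXs.mul_left (4 / L)) ?_
      filter_upwards [hev, eventually_gt_atTop 0] with m hm hm0
      have hm0' : (0 : ℝ) < m := by exact_mod_cast hm0
      rw [Real.norm_of_nonneg (by positivity), div_le_iff₀ hm0', div_mul_eq_mul_div,
        div_mul_eq_mul_div, le_div_iff₀ hLpos]
      linarith
    exact Real.not_summable_one_div_natCast hdiv
  rw [(hYs.mul_left _).tsum_sub (hXs.mul_left _), tsum_mul_left, tsum_mul_left, hL0] at htsum
  unfold fracKernel
  simp only [eX, eY]
  linear_combination -(Real.Gamma (-s))⁻¹ * htsum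

theorem isPowerLike_fracKernel {s : ℝ} (hs : 0 < s) (hs1 : s < 1) :
    ∃ c C, IsPowerLike (2 * s) c C (fun n : ℕ => fracKernel s (n + 1)) :=
  ⟨_, _, isPowerLike_of_recursion hs hs1 (fracKernel_pos hs hs1 (by simp))
    (fracKernel_recursion hs hs1)⟩

/-! ### The heat semigroup -/

/-- The translation `f ↦ f(· + h)` as a bounded operator on the bounded functions on `ℤ`. -/
noncomputable def shiftCLM (h : ℤ) :
    BoundedContinuousFunction ℤ ℝ →L[ℝ] BoundedContinuousFunction ℤ ℝ :=
  LinearMap.mkContinuous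
    { toFun := fun f => f.compContinuous ⟨fun x => x + h, continuous_of_discreteTopology⟩
      map_add' := fun _ _ => rfl
      map_smul' := fun _ _ => rfl } 1 fun f => by
    rw [one_mul]
    exact (BoundedContinuousFunction.norm_le (norm_nonneg f)).2 fun x => f.norm_coe_le_norm (x + h)

theorem shiftCLM_apply (h : ℤ) (f : BoundedContinuousFunction ℤ ℝ) (x : ℤ) :
    shiftCLM h f x = f (x + h) := rfl

theorem shiftCLM_pow_apply (h : ℤ) (n : ℕ) (f : BoundedContinuousFunction ℤ ℝ) (x : ℤ) :
    (shiftCLM h ^ n) f x = f (x + n * h) := by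
  induction n generalizing x with
  | zero => simp
  | succ n ih =>
    rw [pow_succ', mul_apply_eq_comp, shiftCLM_apply, ih]
    congr 1
    push_cast
    ring

theorem commute_shiftCLM (h h' : ℤ) : Commute (shiftCLM h) (shiftCLM h') := by
  ext f x
  simp only [mul_apply_eq_comp, shiftCLM_apply]
  congr 1
  ring

section BoundedOperators

variable {E : Type*} [NormedAddCommGroup E] [NormedSpace ℝ E] [CompleteSpace E]

theorem hasSum_exp_smul_apply (T : E →L[ℝ] E) (t : ℝ) (f : E) (φ : E →L[ℝ] ℝ) :
    HasSum (fun n : ℕ => t ^ n / n.factorial * φ ((T ^ n) f)) (φ (NormedSpace.exp (t • T) f)) := by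
  have h := NormedSpace.exp_series_hasSum_exp' (𝕂 := ℝ) (t • T)
  have h2 := h.mapL (φ.comp (ContinuousLinearMap.apply ℝ E f))
  refine h2.congr_fun fun n => ?_
  rw [smul_pow, smul_smul]
  change _ = φ ((((n.factorial : ℝ)⁻¹ * t ^ n) • (T ^ n)) f)
  rw [smul_apply, map_smul, smul_eq_mul, div_eq_inv_mul]

theorem exp_smul_add_sub_two {A B : E →L[ℝ] E} (hc : Commute A B) (t : ℝ) :
    NormedSpace.exp (t • (A + B - (2 : ℝ) • 1)) =
      Real.exp (-(2 * t)) • (NormedSpace.exp (t • A) * NormedSpace.exp (t • B)) := by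
  let _ : NormedAlgebra ℚ (E →L[ℝ] E) := NormedAlgebra.restrictScalars ℚ ℝ _
  have hc' : Commute (t • A) (t • B) := (hc.smul_left t).smul_right t
  have h1 : t • (A + B - (2 : ℝ) • 1) =
      algebraMap ℝ (E →L[ℝ] E) (-(2 * t)) + (t • A + t • B) := by
    rw [Algebra.algebraMap_eq_smul_one]
    module
  rw [h1, NormedSpace.exp_add_of_commute (Algebra.commutes _ _), NormedSpace.exp_add_of_commute hc',
    ← NormedSpace.algebraMap_exp_comm, ← Real.exp_eq_exp_ℝ, Algebra.algebraMap_eq_smul_one,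
    smul_mul_assoc, one_mul]

/-- The exponential of `A + B - 2`, for commuting operators `A` and `B`, as an iterated series. -/
theorem tsum_pow_add_sub_two {A B : E →L[ℝ] E} (hc : Commute A B) (t : ℝ) (f : E)
    (φ : E →L[ℝ] ℝ) :
    ∑' n : ℕ, t ^ n / n.factorial * φ (((A + B - (2 : ℝ) • 1) ^ n) f) =
      Real.exp (-(2 * t)) * ∑' n : ℕ, t ^ n / n.factorial *
        ∑' m : ℕ, t ^ m / m.factorial * φ ((A ^ n) ((B ^ m) f)) := by
  rw [(hasSum_exp_smul_apply _ t f φ).tsum_eq, exp_smul_add_sub_two hc, smul_apply, map_smul,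
    smul_eq_mul]
  congr 1
  refine (hasSum_exp_smul_apply A t (NormedSpace.exp (t • B) f) φ).tsum_eq.symm.trans ?_
  refine tsum_congr fun n => ?_
  congr 1
  exact (hasSum_exp_smul_apply B t f (φ.comp (A ^ n))).tsum_eq.symm

end BoundedOperators

/-- The discrete Laplacian as a bounded operator. -/
noncomputable def laplacianCLM :
    BoundedContinuousFunction ℤ ℝ →L[ℝ] BoundedContinuousFunction ℤ ℝ :=
  shiftCLM 1 + shiftCLM (-1) - (2 : ℝ) • 1

theorem laplacianCLM_pow_apply (n : ℕ) (f : BoundedContinuousFunction ℤ ℝ) (x : ℤ) :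
    (laplacianCLM ^ n) f x = (discreteLaplacian^[n] f) x := by
  induction n generalizing x with
  | zero => simp
  | succ n ih =>
    rw [pow_succ', mul_apply_eq_comp, Function.iterate_succ_apply']
    simp only [discreteLaplacian, ← ih]
    change (laplacianCLM ^ n) f (x + 1) + (laplacianCLM ^ n) f (x + -1) -
      2 * (laplacianCLM ^ n) f x = _
    simp only [← sub_eq_add_neg]
    ring

theorem summable_exp_mul_exp (t : ℝ) : Summable (fun p : ℕ × ℕ =>
    t ^ p.1 / p.1.factorial * (t ^ p.2 / p.2.factorial)) :=
  summable_mul_of_summable_norm (f := fun n : ℕ => t ^ n / (n.factorial : ℝ))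
    (g := fun n : ℕ => t ^ n / (n.factorial : ℝ))
    (Real.summable_pow_div_factorial t).norm (Real.summable_pow_div_factorial t).norm

/-- The heat semigroup as a random walk with independent Poisson numbers of jumps to the right and
to the left, both with parameter `t`. -/
theorem heatSemigroup_hasSum {t : ℝ} (ht : 0 ≤ t) {u : ℤ → ℝ} (hu : IsBoundedFun u) (x : ℤ) :
    HasSum (fun p : ℕ × ℕ => Real.exp (-(2 * t)) *
      (t ^ p.1 / p.1.factorial * (t ^ p.2 / p.2.factorial)) * u (x + p.1 - p.2))
      (heatSemigroup t u x) := by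
  obtain ⟨C, hC⟩ := hu
  let f : BoundedContinuousFunction ℤ ℝ :=
    BoundedContinuousFunction.ofNormedAddCommGroup u continuous_of_discreteTopology C hC
  have hf : ∀ y, f y = u y := fun _ => rfl
  have hs : Summable (fun p : ℕ × ℕ =>
      t ^ p.1 / p.1.factorial * (t ^ p.2 / p.2.factorial) * u (x + p.1 - p.2)) := by
    refine Summable.of_norm_bounded ((summable_exp_mul_exp t).mul_right C) fun p => ?_
    rw [norm_mul, Real.norm_of_nonneg (by positivity)]
    exact mul_le_mul_of_nonneg_left (hC _) (by positivity)
  have h1 : heatSemigroup t u x = Real.exp (-(2 * t)) * ∑' p : ℕ × ℕ,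
      t ^ p.1 / p.1.factorial * (t ^ p.2 / p.2.factorial) * u (x + p.1 - p.2) := by
    have h2 := tsum_pow_add_sub_two (commute_shiftCLM 1 (-1)) t f
      (BoundedContinuousFunction.evalCLM ℝ x)
    rw [hs.tsum_prod]
    refine Eq.trans (tsum_congr fun n => ?_) (h2.trans ?_)
    · rw [← show (laplacianCLM ^ n) f x = (discreteLaplacian^[n] u) x from
        laplacianCLM_pow_apply n f x]
      rfl
    · congr 1
      refine tsum_congr fun n => ?_
      rw [← tsum_mul_left]
      refine tsum_congr fun m => ?_
      rw [mul_assoc]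
      congr 2
      change (shiftCLM 1 ^ n) ((shiftCLM (-1) ^ m) f) x = _
      rw [shiftCLM_pow_apply, shiftCLM_pow_apply, hf, mul_one, mul_neg_one, ← sub_eq_add_neg]
  rw [h1]
  simp only [mul_assoc (Real.exp _)]
  exact hs.hasSum.mul_left _

theorem heatSemigroup_sub_hasSum {t : ℝ} (ht : 0 ≤ t) {u : ℤ → ℝ} (hu : IsBoundedFun u) (x : ℤ) :
    HasSum (fun p : ℕ × ℕ => Real.exp (-(2 * t)) *
      (t ^ p.1 / p.1.factorial * (t ^ p.2 / p.2.factorial)) * (u (x + p.1 - p.2) - u x))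
      (heatSemigroup t u x - u x) := by
  have hw : HasSum (fun p : ℕ × ℕ => Real.exp (-(2 * t)) *
      (t ^ p.1 / p.1.factorial * (t ^ p.2 / p.2.factorial))) 1 := by
    have h1 := (NormedSpace.expSeries_div_hasSum_exp t).mul
      (NormedSpace.expSeries_div_hasSum_exp t) (summable_exp_mul_exp t)
    have h2 := h1.mul_left (Real.exp (-(2 * t)))
    rwa [← Real.exp_eq_exp_ℝ, ← Real.exp_add, ← Real.exp_add,
      show -(2 * t) + (t + t) = 0 by ring, Real.exp_zero] at h2
  have h := (heatSemigroup_hasSum ht hu x).sub (hw.mul_right (u x))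
  rw [one_mul] at h
  refine h.congr_fun fun p => ?_
  ring

/-- The operator `-(-Δ)^s` is generated by `fracKernel s`: the series of the heat semigroup is
integrated term by term. -/
theorem isGeneratedBy_fracKernel {s : ℝ} (hs : 0 < s) (hs1 : s < 1) :
    IsGeneratedBy (fun u x => -fracDiscreteLaplacian s u x) (fracKernel s) := by
  intro u hu x
  obtain ⟨C, hC⟩ := id hu
  have hdiff : ∀ y, |u y - u x| ≤ 2 * C := fun y => by
    have h1 := abs_le.1 (hC y)
    have h2 := abs_le.1 (hC x)
    rw [abs_le]
    constructor <;> linarith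
  set F : ℕ × ℕ → ℝ → ℝ := fun p t => Real.exp (-(2 * t)) *
    (t ^ p.1 / p.1.factorial * (t ^ p.2 / p.2.factorial)) * (u (x + p.1 - p.2) - u x) *
      t ^ (-1 - s) with hF
  have hF0 : ∀ p : ℕ × ℕ, p.1 = p.2 → F p = 0 := fun p hp => by
    funext t
    simp [hF, hp]
  -- the form in which the integrals are Gamma integrals
  have hFeq : ∀ p : ℕ × ℕ, ∀ t ∈ Set.Ioi (0 : ℝ), F p t =
      (u (x + p.1 - p.2) - u x) / (p.1.factorial * p.2.factorial) *
        (t ^ ((p.1 : ℝ) + p.2 - s - 1) * Real.exp (-(2 * t))) := by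
    intro p t ht
    have ht : 0 < t := ht
    have h1 : t ^ ((p.1 : ℝ) + p.2 - s - 1) = t ^ p.1 * t ^ p.2 * t ^ (-1 - s) := by
      rw [← Real.rpow_natCast, ← Real.rpow_natCast, ← Real.rpow_add ht, ← Real.rpow_add ht]
      congr 1
      ring
    simp only [hF]
    rw [h1]
    field_simp
  have hnorm : ∀ p : ℕ × ℕ, ∀ t ∈ Set.Ioi (0 : ℝ), ‖F p t‖ =
      |u (x + p.1 - p.2) - u x| / (p.1.factorial * p.2.factorial) *
        (t ^ ((p.1 : ℝ) + p.2 - s - 1) * Real.exp (-(2 * t))) := by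
    intro p t ht
    have ht' : 0 < t := ht
    rw [hFeq p t ht, norm_mul, norm_div, Real.norm_eq_abs,
      Real.norm_of_nonneg (by positivity : (0 : ℝ) ≤ p.1.factorial * p.2.factorial),
      Real.norm_of_nonneg (by positivity : 0 ≤ t ^ ((p.1 : ℝ) + p.2 - s - 1) * Real.exp (-(2 * t)))]
  have hgamma : ∀ p : ℕ × ℕ, p.1 ≠ p.2 →
      ∫ t in Set.Ioi (0 : ℝ), t ^ ((p.1 : ℝ) + p.2 - s - 1) * Real.exp (-(2 * t)) =
        (1 / 2) ^ ((p.1 : ℝ) + p.2 - s) * Real.Gamma (p.1 + p.2 - s) := fun p hp =>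
    Real.integral_rpow_mul_exp_neg_mul_Ioi (add_sub_pos_of_ne hs1 hp) two_pos
  have hint : ∀ p, Integrable (F p) (volume.restrict (Set.Ioi 0)) := by
    intro p
    by_cases hp : p.1 = p.2
    · rw [hF0 p hp]
      exact integrable_zero _ _ _
    · have h1 := integrableOn_rpow_mul_exp_neg_mul_rpow (s := (p.1 : ℝ) + p.2 - s - 1) (p := 1)
        (b := 2) (by linarith [add_sub_pos_of_ne hs1 hp]) one_pos two_pos
      have h2 : IntegrableOn (fun t : ℝ => (u (x + p.1 - p.2) - u x) /
          (p.1.factorial * p.2.factorial) *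
          (t ^ ((p.1 : ℝ) + p.2 - s - 1) * Real.exp (-(2 * t)))) (Set.Ioi 0) := by
        simp only [Real.rpow_one, neg_mul] at h1
        exact h1.const_mul _
      exact h2.congr_fun (fun t ht => (hFeq p t ht).symm) measurableSet_Ioi
  have hFint : ∀ p, ∫ t in Set.Ioi (0 : ℝ), F p t = jumpWeight s p * (u (x + p.1 - p.2) - u x) := by
    intro p
    by_cases hp : p.1 = p.2
    · rw [hF0 p hp, jumpWeight, if_pos hp]
      simp
    · rw [setIntegral_congr_fun measurableSet_Ioi (hFeq p), integral_const_mul, hgamma p hp,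
        jumpWeight, if_neg hp]
      ring
  have hFnorm : ∀ p, ∫ t in Set.Ioi (0 : ℝ), ‖F p t‖ =
      jumpWeight s p * |u (x + p.1 - p.2) - u x| := by
    intro p
    by_cases hp : p.1 = p.2
    · rw [hF0 p hp, jumpWeight, if_pos hp]
      simp
    · rw [setIntegral_congr_fun measurableSet_Ioi (hnorm p), integral_const_mul, hgamma p hp,
        jumpWeight, if_neg hp]
      ring
  have hsum : Summable (fun p => ∫ t in Set.Ioi (0 : ℝ), ‖F p t‖) := by
    simp only [hFnorm]
    refine Summable.of_nonneg_of_le (fun p => mul_nonneg (jumpWeight_nonneg hs1 p) (abs_nonneg _))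
      (fun p => ?_) ((summable_jumpWeight hs hs1).mul_right (2 * C))
    exact mul_le_mul_of_nonneg_left (hdiff _) (jumpWeight_nonneg hs1 p)
  have hmain := hasSum_integral_of_summable_integral_norm hint hsum
  have hlhs : ∫ t in Set.Ioi (0 : ℝ), (heatSemigroup t u x - u x) * t ^ (-1 - s) =
      ∫ t in Set.Ioi (0 : ℝ), ∑' p, F p t := by
    refine setIntegral_congr_fun measurableSet_Ioi fun t ht => ?_
    have ht : 0 < t := ht
    exact (((heatSemigroup_sub_hasSum ht.le hu x).mul_right _).tsum_eq).symm
  simp only [hFint] at hmain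
  have hregroup := displacementEquiv.hasSum_iff.2 hmain
  have hk := isKernel_fracKernel hs hs1
  have e1 : ∀ q : ℤ × ℕ, x + ((displacementEquiv q).1 : ℤ) - ((displacementEquiv q).2 : ℤ) =
      x + q.1 := fun q => by
    simp only [displacementEquiv, Equiv.coe_fn_mk]
    omega
  have hfib := hregroup.prod_fiberwise (g := fun j => (∑' m : ℕ, jumpWeight s
      (displacementEquiv (j, m))) * (u (x + j) - u x)) fun j => by
    simp only [Function.comp, e1]
    exact (summable_jumpWeight_fiber hs hs1 j).hasSum.mul_right _
  rw [kernelOp_eq hk]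
  change -((Real.Gamma (-s))⁻¹ * _) = _
  rw [hlhs, ← hfib.tsum_eq, ← neg_mul, ← tsum_mul_left]
  refine tsum_congr fun j => ?_
  rw [fracKernel]
  ring

/-! ### The curvature-dimension inequality -/

/-- Lower bounds for the double sum in terms of the two summands of `cdFun` give the
curvature-dimension inequality. -/
theorem satisfiesCDUpsilon_cdFun {T : (ℤ → ℝ) → ℤ → ℝ} {k : ℤ → ℝ} (hk : IsKernel k)
    (hT : IsGeneratedBy T k) {S : ℝ → ℝ → Prop}
    (hS : ∀ (v : ℤ → ℝ) (K : ℝ), (∀ h, |v h| ≤ K) → v 0 = 0 →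
      S (-∑' h, k h * v h) (∑' p, psi2Term k v p))
    {a b p q q' ν : ℝ} (hb : 0 < b) (hν : 0 < ν) (hq : 0 < q) (hqq' : q ≤ q')
    (hSa : ∀ r A, S r A → 0 < r → a * (r * (r / (1 + r)) ^ (p - 1)) ≤ A)
    (hSb : ∀ r A, S r A → 0 < r → b * ((ν * r / (1 + ν * r)) ^ q * Real.exp (ν * r)) ≤ A) :
    SatisfiesCDUpsilon T 0 (cdFun (a / 4) (b / 4) p q' ν) := by
  refine ⟨k, hk, hT, fun u hu x => ?_⟩
  have hpsi := two_mul_Psi2Upsilon_eq hk hu x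
  have hnn : 0 ≤ Psi2Upsilon k u x := by
    have : 0 ≤ ∑' p, psi2Term k (fun h => u (x + h) - u x) p :=
      tsum_nonneg fun p => psi2Term_nonneg hk p
    linarith
  rw [zero_mul, zero_add, zeroExt]
  split_ifs with hneg
  · exact hnn
  rcases (not_lt.1 hneg).eq_or_lt with h0 | hr
  · rw [← h0, cdFun, mul_zero, zero_div, Real.zero_rpow (by linarith : q' ≠ 0)]
    simpa using hnn
  · obtain ⟨C, hC⟩ := id hu
    have hv : ∀ h, |u (x + h) - u x| ≤ 2 * C := fun h => by
      have h1 := abs_le.1 (hC (x + h))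
      have h2 := abs_le.1 (hC x)
      rw [abs_le]
      constructor <;> linarith
    have hSr := hS (fun h => u (x + h) - u x) (2 * C) hv (by simp)
    rw [← kernelOp_eq hk, ← hT u hu x, ← hpsi] at hSr
    set r := -T u x with hr'
    have h1 := hSa _ _ hSr hr
    have h2 := hSb _ _ hSr hr
    have h3 : (ν * r / (1 + ν * r)) ^ q' ≤ (ν * r / (1 + ν * r)) ^ q := by
      refine Real.rpow_le_rpow_of_exponent_ge (by positivity) ?_ hqq'
      rw [div_le_one (by positivity)]
      linarith
    have h4 := mul_le_mul_of_nonneg_left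
      (mul_le_mul_of_nonneg_right h3 (Real.exp_pos (ν * r)).le) hb.le
    unfold cdFun
    linarith

theorem mainTheorem7 (β : ℝ) (hβ₀ : 0 < β) (hβ₂ : β < 2) :
    ∃ c₁ c₂ c₃ c₄ ν : ℝ, 0 < c₁ ∧ 0 < c₂ ∧ 0 < c₃ ∧ 0 < c₄ ∧ 0 < ν ∧
      (β ≤ (1 + √5) / 2 →
        ∃ F : ℝ → ℝ, IsCDFunction F ∧
          SatisfiesCDUpsilon (fun u x => -fracDiscreteLaplacian (β / 2) u x) 0 F ∧
          F ~[𝓝[>] 0] (fun r => c₁ * r ^ ((1 + 2 * β) / β)) ∧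
          F ~[atTop] (fun r => c₂ * Real.exp (ν * r))) ∧
      ((1 + √5) / 2 < β →
        ∀ ε : ℝ, 0 < ε → ε < β - 1 →
          ∃ F : ℝ → ℝ, IsCDFunction F ∧
            SatisfiesCDUpsilon (fun u x => -fracDiscreteLaplacian (β / 2) u x) 0 F ∧
            F ~[𝓝[>] 0] (fun r => c₃ * r ^ ((β - ε) / (β - ε - 1))) ∧
            F ~[atTop] (fun r => c₄ * Real.exp (ν * r))) := by
  have hs : 0 < β / 2 := by linarith
  have hs1 : β / 2 < 1 := by linarith
  have hk := isKernel_fracKernel hs hs1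
  have hT := isGeneratedBy_fracKernel hs hs1
  obtain ⟨c, C, hpow⟩ := isPowerLike_fracKernel hs hs1
  rw [mul_div_cancel₀ β two_ne_zero] at hpow
  obtain ⟨κ, hκ, hunit⟩ := exists_unitStepBound hk (fracKernel_pos hs hs1 one_ne_zero)
  set S : ℝ → ℝ → Prop := fun r A =>
    ∃ v, UnitStepBound (fun n : ℕ => fracKernel (β / 2) (n + 1)) κ v r A with hS
  have hdiag : ∀ r A, S r A →
      ∃ w, DiagonalBound (fun n : ℕ => fracKernel (β / 2) (n + 1)) w r A :=
    fun r A ⟨v, h⟩ => ⟨_, h.diagonal⟩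
  obtain ⟨R, c', ν, hR, hc', hν, hexp⟩ := exists_exp_le_of_diagonal hβ₀ hpow
  have hE : ∀ r A, S r A → R ≤ r → c' * Real.exp (ν * r) ≤ A := fun r A h => hexp r A (hdiag r A h)
  set p₀ := (1 + 2 * β) / β with hp₀
  have hp₀1 : 1 < p₀ := by
    rw [hp₀, one_lt_div hβ₀]
    linarith
  have hP : ∃ c'' : ℝ, 0 < c'' ∧ ∀ r A, S r A → 0 < r → r ≤ R → c'' * r ^ p₀ ≤ A := by
    obtain ⟨c'', h1, h2⟩ := exists_rpow_le_of_diagonal hβ₀ hpow R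
    exact ⟨c'', h1, fun r A h => h2 r A (hdiag r A h)⟩
  obtain ⟨b, hb, hSb⟩ := exists_mul_exp_le hc' hν (by linarith) hE hP
  obtain ⟨a₁, ha₁, hSa₁⟩ := exists_mul_rpow_le hc' hν hp₀1 hE hP
  have hβ1 : (1 + √5) / 2 < β → 1 < β := fun h => by
    have : 1 ≤ √5 := Real.one_le_sqrt.2 (by norm_num)
    linarith
  obtain ⟨a₂, ha₂, hSa₂⟩ : ∃ a₂ : ℝ, 0 < a₂ ∧ ((1 + √5) / 2 < β → ∀ r A, S r A → 0 < r →
      a₂ * (r * (r / (1 + r)) ^ (β / (β - 1) - 1)) ≤ A) := by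
    by_cases h : (1 + √5) / 2 < β
    · have h1 := hβ1 h
      have h2 : 1 < β / (β - 1) := by
        rw [one_lt_div (by linarith)]
        linarith
      obtain ⟨a₂, ha₂, h3⟩ := exists_mul_rpow_le hc' hν h2 hE
        (exists_rpow_le_of_unitStep h1 hβ₂ hκ hpow hR)
      exact ⟨a₂, ha₂, fun _ => h3⟩
    · exact ⟨1, one_pos, fun h' => absurd h' h⟩
  refine ⟨a₁ / 4, b / 4, a₂ / 4, b / 4, ν, by positivity, by positivity, by positivity,
    by positivity, hν, fun _ => ?_, fun hβ ε hε hεβ => ?_⟩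
  · exact ⟨cdFun (a₁ / 4) (b / 4) p₀ (p₀ + p₀) ν,
      isCDFunction_cdFun (by positivity) (by positivity) hp₀1 (by linarith) hν,
      satisfiesCDUpsilon_cdFun hk hT hunit hb hν (by linarith) (by linarith) hSa₁ hSb,
      cdFun_isEquivalent_zero (by positivity) (by linarith) hν,
      cdFun_isEquivalent_atTop (by positivity) hν⟩
  · have h1 := hβ1 hβ
    set p := (β - ε) / (β - ε - 1) with hp
    -- the exponent `β / (β - 1)` is the limiting case `ε = 0`
    have hpp : β / (β - 1) ≤ p := by
      rw [hp, div_le_div_iff₀ (by linarith) (by linarith)]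
      linarith
    have hp1 : 1 < p := by
      rw [hp, one_lt_div (by linarith)]
      linarith
    have hSa : ∀ r A, S r A → 0 < r → a₂ * (r * (r / (1 + r)) ^ (p - 1)) ≤ A := by
      intro r A h hr
      refine le_trans ?_ (hSa₂ hβ r A h hr)
      have h2 : (r / (1 + r)) ^ (p - 1) ≤ (r / (1 + r)) ^ (β / (β - 1) - 1) := by
        refine Real.rpow_le_rpow_of_exponent_ge (by positivity) ?_ (by linarith)
        rw [div_le_one (by positivity)]
        linarith
      gcongr
    exact ⟨cdFun (a₂ / 4) (b / 4) p (p + p₀) ν,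
      isCDFunction_cdFun (by positivity) (by positivity) hp1 (by linarith) hν,
      satisfiesCDUpsilon_cdFun hk hT hunit hb hν (by linarith) (by linarith) hSa hSb,
      cdFun_isEquivalent_zero (by positivity) (by linarith) hν,
      cdFun_isEquivalent_atTop (by positivity) hν⟩
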